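/- For $x>0$ and complex $s$ with $\operatorname{Re} s>-\tfrac12$ let $$T[s,x]=\int_0^\infty\frac{\cos(xu)}{(u^2+1)^{s+1/2}}\,du ,$$ the integral being understood as $\lim_{R\to\infty}\int_0^R$. For $n\ge 1$ let $p_n$ be the polynomial $$p_n(X)=\sum_{k=0}^{n-1}(X-i\pi)^{n-1-k}(X+i\pi)^{k},$$ and for $0\le k<n$ and $y>0$ let $$f[n,k,y]=\bigl(i\pi+\log(y+1)\bigr)^{n-k}-\bigl(-i\pi+\log(y+1)\bigr)^{n-k}.$$ Then for every $n\ge1$ and every $x>0$ the function $s\mapsto T[s,x]$ is $n$ times continuously (complex) differentiable at $s=\tfrac12$, all integrals below converge absolutely, and $$\frac{d^n}{ds^n}T[s,x]\Big|_{s=1/2}=(-1)^n\int_0^\infty\cos(xu)\,\frac{\log^n(u^2+1)}{u^2+1}\,du=(-1)^n\,T[\tfrac12,x]\,\bigl(A_1+A_2+A_3+A_4\bigr),$$ where $$A_1=\operatorname{Re}\Bigl(\frac1{2\pi}\int_{-\pi}^{\pi}(\log 2+i\varphi)^n\,d\varphi\Bigr),$$ $$A_2=-\int_0^\infty e^{-xu}\,p_n\bigl(\log(u+2)+\log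 u\bigr)\frac{du}{u+2},$$ $$A_3=x\sum_{k=0}^{n-1}\binom nk\int_0^\infty e^{-xu}\operatorname{Re}\Bigl(\frac1{2\pi i}f[n,k,u+1]\Bigr)\frac{\log^{k+1}u}{k+1}\,du,$$ $$A_4=-\sum_{k=0}^{n-1}\binom nk\int_0^\infty e^{-xu}\operatorname{Re}\Bigl(\frac1{2\pi i}\frac{d}{du}f[n,k,u+1]\Bigr)\frac{\log^{k+1}u}{k+1}\,du .$$ Moreover, $A_1$ is a polynomial in $\pi$ and $\log 2$ with rational coefficients, and, with $$U[a,b,\varepsilon]=\int_0^\infty e^{-xu}\,\frac{\log^a(u+2)\,\log^b(u)}{(u+2)^{\varepsilon}}\,du ,$$ $A_2$ and $A_4$ are finite linear combinations of the integrals $U[a,b,1]$, and $A_3$ is $x$ times a finite linear combination of the integrals $U[a,b,0]$, where $0\le a,b\le n$ and the coefficients are real and depend only on $n$, $a$ and $b$. -/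

import Mathlib

open Filter Topology MeasureTheory Set Polynomial

namespace BesselOrder

noncomputable section

/-- The integral of `cos (x u) / (u ^ 2 + 1) ^ (s + 1 / 2)` over `[0, R]`, for complex `s`. -/
def partialT (s : ℂ) (x R : ℝ) : ℂ :=
  ∫ u in (0 : ℝ)..R, (Real.cos (x * u) : ℂ) / ((u ^ 2 + 1 : ℝ) : ℂ) ^ (s + 1 / 2)

/-- `T[s, x] = ∫_0^∞ cos (x u) / (u ^ 2 + 1) ^ (s + 1 / 2) du`, for `Re s > -1/2` and `x > 0`.
The integral over the half line is the limit of the integrals over `[0, R]`, since it converges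
only conditionally for `-1/2 < Re s ≤ 0`. -/
def T (s : ℂ) (x : ℝ) : ℂ :=
  limUnder atTop (fun R : ℝ => partialT s x R)

/-- The polynomial `p_n` (for `n ≥ 1`): the symmetric form `∑_{k<n} U^(n-1-k) V^k` in
`U = X - iπ` and `V = X + iπ`, which satisfy `U + V = 2 X` and `U V = π² + X²`; the
variable `X` stands for `log (y + 1) + log (y - 1)`. -/
def p (n : ℕ) : ℂ[X] :=
  ∑ k ∈ Finset.range n,
    (X - C (Complex.I * Real.pi)) ^ (n - 1 - k) * (X + C (Complex.I * Real.pi)) ^ k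

/-- `f[n, k, y] = (iπ + log (y + 1))^(n-k) - (-iπ + log (y + 1))^(n-k)`, used for `k < n`. -/
def f (n k : ℕ) (y : ℝ) : ℂ :=
  (Complex.I * Real.pi + Real.log (y + 1)) ^ (n - k) -
    (-(Complex.I * Real.pi) + Real.log (y + 1)) ^ (n - k)

/-- `A_1[n]`; it does not depend on `x`. -/
def A₁ (n : ℕ) : ℝ :=
  ((1 / (2 * Real.pi) : ℂ) *
    ∫ φ in (-Real.pi)..Real.pi, ((Real.log 2 : ℂ) + Complex.I * φ) ^ n).re

/-- The integrand of `A_2[n, x]`. -/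
def integrand₂ (n : ℕ) (x u : ℝ) : ℂ :=
  (Real.exp (-(x * u)) : ℂ) *
    (p n).eval ((Real.log (u + 2) + Real.log u : ℝ) : ℂ) / ((u + 2 : ℝ) : ℂ)

def A₂ (n : ℕ) (x : ℝ) : ℂ :=
  -∫ u in Ioi (0 : ℝ), integrand₂ n x u

/-- The integrand of the `k`-th term of `A_3[n, x]`. -/
def integrand₃ (n k : ℕ) (x u : ℝ) : ℝ :=
  Real.exp (-(x * u)) * (1 / (2 * Real.pi * Complex.I) * f n k (u + 1)).re *
    (Real.log u ^ (k + 1) / (k + 1))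

def A₃ (n : ℕ) (x : ℝ) : ℝ :=
  x * ∑ k ∈ Finset.range n, (n.choose k : ℝ) * ∫ u in Ioi (0 : ℝ), integrand₃ n k x u

/-- The integrand of the `k`-th term of `A_4[n, x]`. -/
def integrand₄ (n k : ℕ) (x u : ℝ) : ℝ :=
  Real.exp (-(x * u)) *
    (1 / (2 * Real.pi * Complex.I) * deriv (fun v : ℝ => f n k (v + 1)) u).re *
    (Real.log u ^ (k + 1) / (k + 1))

def A₄ (n : ℕ) (x : ℝ) : ℝ :=
  -∑ k ∈ Finset.range n, (n.choose k : ℝ) * ∫ u in Ioi (0 : ℝ), integrand₄ n k x u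

/-- The integrand of the Laplace-type integral `U[a, b, ε]`. -/
def integrandU (a b ε : ℕ) (x u : ℝ) : ℝ :=
  Real.exp (-(x * u)) * (Real.log (u + 2) ^ a * Real.log u ^ b) / (u + 2) ^ ε

/-- `U[a, b, ε] = ∫_0^∞ e^(-x u) log^a (u + 2) log^b u / (u + 2)^ε du`, as a function of `x`. -/
def U (a b ε : ℕ) (x : ℝ) : ℝ :=
  ∫ u in Ioi (0 : ℝ), integrandU a b ε x u

end

end BesselOrder

/-!
Write `L = log (1 + u^2)`. Near `s = 1/2` the integrand of `T[s, x]` is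
`cos (x u) / (1 + u^2) * exp (-(s - 1/2) L)`, dominated together with all its `s`-derivatives by
integrable functions, so differentiation under the integral sign (`iteratedDeriv_T`) gives the
first expression `(-1)^n ∫ cos (x u) L^n / (1 + u^2)` of the derivative.

For the second one, `∫_0^∞ e^(i x t) log^n (1 + t^2) / (1 + t^2) dt` is moved from the positive
real to the positive imaginary axis. The principal branch of `log (1 + z^2)` is holomorphic on
`Re z > 0`, and the axis is approached from the right along `Re z = d`. There the integrand would
acquire a non-integrable singularity at `z = i`; integrating by parts first, through
`2 i / (1 + z^2) = (log (1 + z^2))' - 2 / (z + i)`, leaves only powers of the logarithm, and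
dominated convergence applies as `d → 0` (`integral_g_eq`). On the segment `[0, i]` the resulting
integrand has real part zero, and at `z = i (u + 1)` the logarithm is
`log (u + 2) + log u + iπ`. With the real polynomials `q_m(t) = Im ((t + iπ)^m) / π` this is
`integral_cos_mul_log_pow`:
`∫_0^∞ cos (x u) L^n / (1 + u^2) du = (π/2) e^(-x) S_n`, where, for `a = log (u + 2)` and
`l = log u`,
`S_n = x/(n+1) ∫ e^(-x u) q_(n+1)(a + l) du - 2 ∫ e^(-x u) q_n(a + l) du/(u + 2)`.
The case `n = 0`, where `S_0 = 1`, evaluates `T[1/2, x]`.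

Finally `S_n = A_1 + A_2 + A_3 + A_4` (`sum_A_eq`): `p_n = q_n`, `A_1 = q_(n+1)(log 2)/(n + 1)`,
and by Taylor's formula for `q` the sums over `k` in `A_3` and `A_4` collapse to
`(q_(n+1)(a + l) - q_(n+1)(a))/(n + 1)` and `(q_n(a + l) - q_n(a))/(u + 2)`; the terms without
`l` cancel against `A_1` by an integration by parts. That the `q_m` are real polynomials, with
values in `ℚ[π, log 2]` at `log 2`, gives the statements about `U[a, b, ε]` and `A_1`.
-/

namespace BesselOrder

/-! ### The polynomials `q` -/

/-- The real polynomial function `q_m(t) = Im ((t + iπ)^m) / π`. -/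
noncomputable def q (m : ℕ) (t : ℝ) : ℝ := (((t : ℂ) + Real.pi * Complex.I) ^ m).im / Real.pi

/-- The companion of `q`: the real part of `(t + iπ)^m`. -/
noncomputable def r (m : ℕ) (t : ℝ) : ℝ := (((t : ℂ) + Real.pi * Complex.I) ^ m).re

theorem q_zero (t : ℝ) : q 0 t = 0 := by simp [q]

theorem q_one (t : ℝ) : q 1 t = 1 := by simp [q, Real.pi_ne_zero]

theorem q_succ (m : ℕ) (t : ℝ) : q (m + 1) t = t * q m t + r m t := by
  have := Real.pi_ne_zero
  simp only [q, r, pow_succ, Complex.mul_im, Complex.add_im, Complex.add_re, Complex.ofReal_re,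
    Complex.ofReal_im, Complex.mul_re, Complex.I_re, Complex.I_im]
  field_simp
  ring

theorem r_succ (m : ℕ) (t : ℝ) : r (m + 1) t = t * r m t - Real.pi ^ 2 * q m t := by
  have := Real.pi_ne_zero
  simp only [q, r, pow_succ, Complex.mul_im, Complex.add_im, Complex.add_re, Complex.ofReal_re,
    Complex.ofReal_im, Complex.mul_re, Complex.I_re, Complex.I_im]
  field_simp
  ring

/-- The difference of powers in `f` and `p` is that of a number and its conjugate. -/
theorem pow_sub_conj_pow (m : ℕ) (t : ℝ) :
    (Complex.I * Real.pi + t) ^ m - (-(Complex.I * Real.pi) + t) ^ m =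
      2 * Real.pi * Complex.I * (q m t : ℂ) := by
  have hpi : (Real.pi : ℂ) ≠ 0 := by exact_mod_cast Real.pi_ne_zero
  have h2 : (-(Complex.I * Real.pi) + (t : ℂ)) = (starRingEnd ℂ) (Complex.I * Real.pi + t) := by
    simp
  rw [h2, ← map_pow, Complex.sub_conj, q, add_comm, mul_comm Complex.I]
  push_cast
  field_simp

theorem one_div_mul_f (n k : ℕ) (u : ℝ) :
    1 / (2 * Real.pi * Complex.I) * f n k (u + 1) = (q (n - k) (Real.log (u + 2)) : ℂ) := by
  have hpi : (Real.pi : ℂ) ≠ 0 := by exact_mod_cast Real.pi_ne_zero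
  have h : u + 1 + 1 = u + 2 := by ring
  rw [f, pow_sub_conj_pow, h]
  field_simp

theorem eval_p (n : ℕ) (t : ℝ) : (p n).eval (t : ℂ) = (q n t : ℂ) := by
  have hpi : (Real.pi : ℂ) ≠ 0 := by exact_mod_cast Real.pi_ne_zero
  have h := (Commute.all ((t : ℂ) + Complex.I * Real.pi) (t - Complex.I * Real.pi)).geom_sum₂_mul n
  have h1 := pow_sub_conj_pow n t
  have h2 : (p n).eval (t : ℂ) = ∑ i ∈ Finset.range n,
      ((t : ℂ) + Complex.I * Real.pi) ^ i * (t - Complex.I * Real.pi) ^ (n - 1 - i) := by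
    simp [p, eval_finsetSum, mul_comm]
  rw [← h2] at h
  rw [add_comm _ (t : ℂ), add_comm _ (t : ℂ), ← sub_eq_add_neg, ← h] at h1
  have h3 : (2 * Real.pi * Complex.I : ℂ) ≠ 0 := by simp [hpi]
  apply mul_left_cancel₀ h3
  rw [← h1]
  ring

/-- Taylor expansion of `q_m`. -/
theorem q_add (m : ℕ) (t l : ℝ) :
    q m (t + l) = ∑ j ∈ Finset.range (m + 1), (m.choose j : ℝ) * l ^ j * q (m - j) t := by
  have h : ((t + l : ℝ) : ℂ) + Real.pi * Complex.I = l + (t + Real.pi * Complex.I) := by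
    push_cast; ring
  rw [q, h, add_pow, Complex.im_sum, Finset.sum_div]
  refine Finset.sum_congr rfl fun j _ => ?_
  have : (l : ℂ) ^ j * (t + Real.pi * Complex.I) ^ (m - j) * (m.choose j : ℂ) =
      ((l ^ j * m.choose j : ℝ) : ℂ) * (t + Real.pi * Complex.I) ^ (m - j) := by
    push_cast; ring
  rw [this, Complex.im_ofReal_mul, q]
  ring

theorem hasDerivAt_q (m : ℕ) (t : ℝ) : HasDerivAt (q m) (m * q (m - 1) t) t := by
  have h1 : HasDerivAt (fun z : ℂ => (z + Real.pi * Complex.I) ^ m)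
      (m * ((t : ℂ) + Real.pi * Complex.I) ^ (m - 1)) (t : ℂ) := by
    simpa using ((hasDerivAt_id' (t : ℂ)).add_const (Real.pi * Complex.I : ℂ)).fun_pow m
  have h2 := h1.comp_ofReal
  have h3 : HasDerivAt (fun y : ℝ => (((y : ℂ) + Real.pi * Complex.I) ^ m).im)
      ((m * ((t : ℂ) + Real.pi * Complex.I) ^ (m - 1)).im) t :=
    (Complex.imCLM.hasFDerivAt.comp_hasDerivAt t h2)
  refine (h3.div_const Real.pi).congr_deriv ?_
  rw [q, ← Complex.ofReal_natCast, Complex.im_ofReal_mul]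
  ring

theorem deriv_f (n k : ℕ) {u : ℝ} (hu : 0 < u) :
    (1 / (2 * Real.pi * Complex.I) * deriv (fun v : ℝ => f n k (v + 1)) u).re =
      ((n - k : ℕ) : ℝ) * q (n - k - 1) (Real.log (u + 2)) / (u + 2) := by
  have hpi : (Real.pi : ℂ) ≠ 0 := by exact_mod_cast Real.pi_ne_zero
  have h1 : (fun v : ℝ => f n k (v + 1)) =
      fun v : ℝ => 2 * Real.pi * Complex.I * ((q (n - k) (Real.log (v + 2)) : ℝ) : ℂ) := by
    funext v
    rw [← one_div_mul_f]
    field_simp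
  have h2 : HasDerivAt (fun v : ℝ => Real.log (v + 2)) (1 / (u + 2)) u :=
    ((hasDerivAt_id u).add_const 2).log (by positivity)
  have h3 := (((hasDerivAt_q (n - k) (Real.log (u + 2))).comp u h2).ofReal_comp).const_mul
    (2 * Real.pi * Complex.I : ℂ)
  have h4 := h3.deriv
  simp only [Function.comp_apply, ← h1] at h4
  rw [h4, ← mul_assoc, one_div_mul_cancel (by simp [hpi]), one_mul, Complex.ofReal_re]
  ring

theorem A₁_eq (n : ℕ) : A₁ n = q (n + 1) (Real.log 2) / (n + 1) := by
  have hpi : (Real.pi : ℂ) ≠ 0 := by exact_mod_cast Real.pi_ne_zero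
  have hn : (n + 1 : ℂ) ≠ 0 := by exact_mod_cast n.succ_ne_zero
  have hd : ∀ φ : ℝ, HasDerivAt
      (fun φ : ℝ => ((Real.log 2 : ℂ) + Complex.I * φ) ^ (n + 1) / ((n + 1) * Complex.I))
      (((Real.log 2 : ℂ) + Complex.I * φ) ^ n) φ := by
    intro φ
    have h1 : HasDerivAt (fun φ : ℝ => (Real.log 2 : ℂ) + Complex.I * φ) (Complex.I * 1) φ :=
      ((Complex.ofRealCLM.hasDerivAt (x := φ)).const_mul Complex.I).const_add _
    refine ((h1.fun_pow (n + 1)).div_const ((n + 1) * Complex.I)).congr_deriv ?_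
    push_cast
    field_simp
  have hi := intervalIntegral.integral_eq_sub_of_hasDerivAt (a := -Real.pi) (b := Real.pi)
    (fun φ _ => hd φ) (Continuous.intervalIntegrable (by fun_prop) _ _)
  have h3 := pow_sub_conj_pow (n + 1) (Real.log 2)
  have h4 : (1 / (2 * Real.pi) : ℂ) *
      ∫ φ in (-Real.pi)..Real.pi, ((Real.log 2 : ℂ) + Complex.I * φ) ^ n =
      ((q (n + 1) (Real.log 2) / (n + 1) : ℝ) : ℂ) := by
    rw [hi, ← sub_div]
    push_cast
    rw [add_comm (Real.log 2 : ℂ), add_comm (Real.log 2 : ℂ), mul_neg, h3]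
    field_simp
  rw [A₁, h4, Complex.ofReal_re]

/-- Joint induction on the real and imaginary parts shows that both are rational polynomials in
`π` and `t`. -/
theorem exists_mvPolynomial_q_r (m : ℕ) (t : ℝ) :
    (∃ P : MvPolynomial (Fin 2) ℚ, q m t = MvPolynomial.aeval ![Real.pi, t] P) ∧
      ∃ P : MvPolynomial (Fin 2) ℚ, r m t = MvPolynomial.aeval ![Real.pi, t] P := by
  induction m with
  | zero => exact ⟨⟨0, by simp [q]⟩, ⟨1, by simp [r]⟩⟩
  | succ m ih =>
    obtain ⟨⟨P, hP⟩, R, hR⟩ := ih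
    refine ⟨⟨MvPolynomial.X 1 * P + R, ?_⟩, ⟨MvPolynomial.X 1 * R - MvPolynomial.X 0 ^ 2 * P, ?_⟩⟩
    · simp [q_succ, hP, hR]
    · simp [r_succ, hP, hR]

theorem exists_mvPolynomial_A₁ (n : ℕ) : ∃ P : MvPolynomial (Fin 2) ℚ,
    A₁ n = MvPolynomial.aeval ![Real.pi, Real.log 2] P := by
  obtain ⟨P, hP⟩ := (exists_mvPolynomial_q_r (n + 1) (Real.log 2)).1
  refine ⟨MvPolynomial.C (1 / (n + 1 : ℚ)) * P, ?_⟩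
  rw [A₁_eq, hP, map_mul, MvPolynomial.aeval_C]
  simp
  ring

/-! ### Laplace integrals of logarithms -/

theorem exp_abs_log_div_four_le {t : ℝ} (ht : 0 < t) :
    Real.exp (|Real.log t| / 4) ≤ t ^ (1 / 4 : ℝ) + t ^ (-(1 / 4) : ℝ) := by
  rw [Real.rpow_def_of_pos ht, Real.rpow_def_of_pos ht]
  rcases abs_choice (Real.log t) with h | h <;> rw [h]
  · refine le_trans (le_of_eq ?_) (le_add_of_nonneg_right (Real.exp_pos _).le)
    congr 1; ring
  · refine le_trans (le_of_eq ?_) (le_add_of_nonneg_left (Real.exp_pos _).le)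
    congr 1; ring

/-- Powers of the logarithm grow slower than `t ^ (1 / 4)` at infinity and `t ^ (-1 / 4)` at
zero. -/
theorem abs_log_pow_le (m : ℕ) {t : ℝ} (ht : 0 < t) :
    |Real.log t| ^ m ≤ (m.factorial * 4 ^ m : ℝ) * (t ^ (1 / 4 : ℝ) + t ^ (-(1 / 4) : ℝ)) := by
  have h := (Real.pow_div_factorial_le_exp (|Real.log t| / 4) (by positivity) m).trans
    (exp_abs_log_div_four_le ht)
  rw [div_pow, div_div, div_le_iff₀ (by positivity)] at h
  linarith

/-- An integrable majorant for all integrands with logarithmic singularities at the origin. -/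
noncomputable def logMajorant (x t : ℝ) : ℝ :=
  Real.exp (-(x * |t|)) * ((|t| + 3) * (|t| ^ (1 / 4 : ℝ) + |t| ^ (-(1 / 4) : ℝ)))

theorem integrable_logMajorant {x : ℝ} (hx : 0 < x) : Integrable (logMajorant x) := by
  have hpos : IntegrableOn (logMajorant x) (Ioi 0) := by
    have h : ∀ s : ℝ, -1 < s → IntegrableOn (fun u : ℝ => u ^ s * Real.exp (-x * u)) (Ioi 0) := by
      intro s hs
      simpa using integrableOn_rpow_mul_exp_neg_mul_rpow hs one_pos hx
    refine ((((h (5 / 4) (by norm_num)).add (h (3 / 4) (by norm_num))).add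
      ((h (1 / 4) (by norm_num)).const_mul 3)).add
      ((h (-(1 / 4)) (by norm_num)).const_mul 3)).congr_fun (fun u hu => ?_) measurableSet_Ioi
    have hu : 0 < u := hu
    have e1 : u ^ (5 / 4 : ℝ) = u * u ^ (1 / 4 : ℝ) := by
      rw [← Real.rpow_one_add' hu.le (by norm_num)]; norm_num
    have e2 : u ^ (3 / 4 : ℝ) = u * u ^ (-(1 / 4) : ℝ) := by
      rw [← Real.rpow_one_add' hu.le (by norm_num)]; norm_num
    simp only [logMajorant, abs_of_pos hu, Pi.add_apply, e1, e2, neg_mul]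
    ring
  rw [← integrableOn_univ, ← Iio_union_Ici (a := (0 : ℝ)), integrableOn_union,
    integrableOn_Ici_iff_integrableOn_Ioi]
  refine ⟨?_, hpos⟩
  have h := hpos.comp_neg
  have he : (fun t => logMajorant x (-t)) = logMajorant x := by funext t; simp [logMajorant]
  rw [he] at h
  simpa using h

theorem log_add_two_pow_le (a : ℕ) {u : ℝ} (hu : 0 ≤ u) :
    |Real.log (u + 2)| ^ a ≤ a.factorial * (u + 2) := by
  have h0 : 0 ≤ Real.log (u + 2) := Real.log_nonneg (by linarith)
  have h := Real.pow_div_factorial_le_exp _ h0 a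
  rw [Real.exp_log (by linarith), div_le_iff₀ (by positivity)] at h
  rw [abs_of_nonneg h0]
  linarith

theorem integrableOn_integrandU (a b ε : ℕ) {x : ℝ} (hx : 0 < x) :
    IntegrableOn (integrandU a b ε x) (Ioi 0) := by
  refine Integrable.mono' ((integrable_logMajorant hx).integrableOn.const_mul
    (a.factorial * (b.factorial * 4 ^ b))) ?_ ?_
  · unfold integrandU
    exact Measurable.aestronglyMeasurable (by fun_prop)
  · refine (ae_restrict_iff' measurableSet_Ioi).2 (Eventually.of_forall fun u hu => ?_)
    have hu : 0 < u := hu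
    have h1 := log_add_two_pow_le a hu.le
    have h2 := abs_log_pow_le b hu
    have h3 : (1 : ℝ) ≤ (u + 2) ^ ε := one_le_pow₀ (by linarith)
    rw [integrandU, Real.norm_eq_abs, abs_div, abs_mul, abs_mul, abs_pow, abs_pow,
      abs_of_pos (Real.exp_pos _), abs_of_pos (by positivity : 0 < (u + 2) ^ ε)]
    refine (div_le_self (by positivity) h3).trans ?_
    rw [logMajorant, abs_of_pos hu]
    calc _ ≤ Real.exp (-(x * u)) * ((a.factorial * (u + 3)) *
          ((b.factorial * 4 ^ b : ℝ) * (u ^ (1 / 4 : ℝ) + u ^ (-(1 / 4) : ℝ)))) := by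
          gcongr
          exact h1.trans (by gcongr; norm_num)
      _ = _ := by ring

/-- The Laplace-type integral `∫_0^∞ e^(-x u) φ(log (u + 2), log u) / (u + 2)^ε du`. -/
noncomputable def logLaplace (φ : ℝ → ℝ → ℝ) (ε : ℕ) (x : ℝ) : ℝ :=
  ∫ u in Ioi (0 : ℝ), Real.exp (-(x * u)) * φ (Real.log (u + 2)) (Real.log u) / (u + 2) ^ ε

/-- `LogComb N φ` says that `φ a l` is a real polynomial in `a` and `l` of degree at most `N` in
each variable; below, `a = log (u + 2)` and `l = log u`. -/
def LogComb (N : ℕ) (φ : ℝ → ℝ → ℝ) : Prop :=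
  ∃ c : ℕ → ℕ → ℝ, ∀ a l, φ a l =
    ∑ i ∈ Finset.range (N + 1), ∑ j ∈ Finset.range (N + 1), c i j * (a ^ i * l ^ j)

namespace LogComb

variable {N : ℕ} {φ ψ : ℝ → ℝ → ℝ}

theorem add (h₁ : LogComb N φ) (h₂ : LogComb N ψ) : LogComb N fun a l => φ a l + ψ a l := by
  obtain ⟨c, hc⟩ := h₁
  obtain ⟨d, hd⟩ := h₂
  exact ⟨fun i j => c i j + d i j, fun a l => by simp [hc, hd, add_mul, Finset.sum_add_distrib]⟩

theorem const_mul (h : LogComb N φ) (s : ℝ) : LogComb N fun a l => s * φ a l := by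
  obtain ⟨c, hc⟩ := h
  exact ⟨fun i j => s * c i j, fun a l => by simp [hc, Finset.mul_sum, mul_assoc]⟩

theorem sum {k : ℕ} {φ : ℕ → ℝ → ℝ → ℝ} (h : ∀ i < k, LogComb N (φ i)) :
    LogComb N fun a l => ∑ i ∈ Finset.range k, φ i a l := by
  induction k with
  | zero => exact ⟨0, by simp⟩
  | succ k ih =>
    simp only [Finset.sum_range_succ]
    exact (ih fun i hi => h i (by omega)).add (h k (by omega))

theorem monomial {i j : ℕ} (hi : i ≤ N) (hj : j ≤ N) : LogComb N fun a l => a ^ i * l ^ j := by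
  refine ⟨fun i' j' => if i' = i then if j' = j then 1 else 0 else 0, fun a l => ?_⟩
  simp [ite_mul, Finset.sum_ite_eq', Nat.lt_succ_of_le hi, Nat.lt_succ_of_le hj,
    Finset.sum_ite_irrel]

/-- `q_m(a) l^j` is a combination of monomials, by the binomial formula. -/
theorem q_mul_pow {m j : ℕ} (hm : m ≤ N) (hj : j ≤ N) : LogComb N fun a l => q m a * l ^ j := by
  have h : (fun a l => q m a * l ^ j) = fun a l : ℝ => ∑ i ∈ Finset.range (m + 1),
      (m.choose i * q (m - i) 0) * (a ^ i * l ^ j) := by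
    funext a l
    rw [← zero_add a, q_add m 0 a, zero_add, Finset.sum_mul]
    exact Finset.sum_congr rfl fun i _ => by ring
  rw [h]
  exact sum fun i hi => (monomial (by omega) hj).const_mul _

theorem q_add {m : ℕ} (hm : m ≤ N) : LogComb N fun a l => q m (a + l) := by
  simp only [BesselOrder.q_add]
  refine sum fun j hj => ?_
  have := (q_mul_pow (N := N) (m := m - j) (j := j) (by omega) (by omega)).const_mul (m.choose j)
  refine (congrArg (LogComb N) ?_).mp this
  funext a l; ring

theorem integrand_eq {c : ℕ → ℕ → ℝ} (hc : ∀ a l, φ a l =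
    ∑ i ∈ Finset.range (N + 1), ∑ j ∈ Finset.range (N + 1), c i j * (a ^ i * l ^ j))
    (ε : ℕ) (x u : ℝ) :
    Real.exp (-(x * u)) * φ (Real.log (u + 2)) (Real.log u) / (u + 2) ^ ε =
      ∑ i ∈ Finset.range (N + 1), ∑ j ∈ Finset.range (N + 1), c i j * integrandU i j ε x u := by
  rw [hc, Finset.mul_sum, Finset.sum_div]
  refine Finset.sum_congr rfl fun i _ => ?_
  rw [Finset.mul_sum, Finset.sum_div]
  refine Finset.sum_congr rfl fun j _ => ?_
  rw [integrandU]
  ring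

theorem integrableOn (h : LogComb N φ) (ε : ℕ) {x : ℝ} (hx : 0 < x) : IntegrableOn (fun u : ℝ =>
    Real.exp (-(x * u)) * φ (Real.log (u + 2)) (Real.log u) / (u + 2) ^ ε) (Ioi 0) := by
  obtain ⟨c, hc⟩ := h
  simp only [integrand_eq hc]
  exact integrable_finsetSum _ fun i _ => integrable_finsetSum _ fun j _ =>
    (integrableOn_integrandU i j ε hx).const_mul _

theorem exists_logLaplace_eq (h : LogComb N φ) (ε : ℕ) : ∃ c : ℕ → ℕ → ℝ, ∀ x : ℝ, 0 < x →
    logLaplace φ ε x = ∑ i ∈ Finset.range (N + 1), ∑ j ∈ Finset.range (N + 1), c i j * U i j ε x := by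
  obtain ⟨c, hc⟩ := h
  refine ⟨c, fun x hx => ?_⟩
  simp only [logLaplace, integrand_eq hc]
  rw [integral_finsetSum _ fun i _ => integrable_finsetSum _ fun j _ =>
    (integrableOn_integrandU i j ε hx).const_mul _]
  refine Finset.sum_congr rfl fun i _ => ?_
  rw [integral_finsetSum _ fun j _ => (integrableOn_integrandU i j ε hx).const_mul _]
  refine Finset.sum_congr rfl fun j _ => ?_
  rw [integral_const_mul, U]

end LogComb

theorem logLaplace_add {N : ℕ} {φ ψ : ℝ → ℝ → ℝ} (hφ : LogComb N φ) (hψ : LogComb N ψ) (ε : ℕ)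
    {x : ℝ} (hx : 0 < x) :
    logLaplace (fun a l => φ a l + ψ a l) ε x = logLaplace φ ε x + logLaplace ψ ε x := by
  simp only [logLaplace]
  rw [← integral_add (hφ.integrableOn ε hx) (hψ.integrableOn ε hx)]
  simp only [mul_add, add_div]

theorem logLaplace_const_mul (φ : ℝ → ℝ → ℝ) (s : ℝ) (ε : ℕ) (x : ℝ) :
    logLaplace (fun a l => s * φ a l) ε x = s * logLaplace φ ε x := by
  simp only [logLaplace]
  rw [← integral_const_mul]
  congr 1
  funext u
  ring

theorem logLaplace_sum {N k : ℕ} {φ : ℕ → ℝ → ℝ → ℝ} (h : ∀ i < k, LogComb N (φ i)) (ε : ℕ)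
    {x : ℝ} (hx : 0 < x) :
    logLaplace (fun a l => ∑ i ∈ Finset.range k, φ i a l) ε x =
      ∑ i ∈ Finset.range k, logLaplace (φ i) ε x := by
  simp only [logLaplace]
  rw [← integral_finsetSum _ fun i hi => (h i (Finset.mem_range.1 hi)).integrableOn ε hx]
  simp only [Finset.mul_sum, Finset.sum_div]

/-! ### The sum of the four terms -/

/-- The sum over `k` in `A_3`: Taylor's formula for `q_(n+1)`, with
`C(n, k) / (k + 1) = C(n + 1, k + 1) / (n + 1)`. -/
theorem sum_choose_mul_q (n : ℕ) (a l : ℝ) :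
    ∑ k ∈ Finset.range n, (n.choose k : ℝ) * (1 / (k + 1) * (q (n - k) a * l ^ (k + 1))) =
      1 / (n + 1) * (q (n + 1) (a + l) + -1 * q (n + 1) a) := by
  have hn : (n + 1 : ℝ) ≠ 0 := by positivity
  rw [q_add (n + 1), Finset.sum_range_succ', Finset.sum_range_succ]
  simp only [Nat.sub_self, Nat.add_sub_add_right, q_zero, pow_zero, Nat.sub_zero,
    Nat.choose_zero_right, mul_zero, Nat.cast_one, one_mul, add_zero]
  rw [neg_one_mul, add_neg_cancel_right, Finset.mul_sum]
  refine Finset.sum_congr rfl fun k _ => ?_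
  have h : ((n + 1 : ℕ) * n.choose k : ℝ) = (n + 1).choose (k + 1) * (k + 1 : ℕ) := by
    exact_mod_cast Nat.add_one_mul_choose_eq n k
  push_cast at h
  field_simp
  linear_combination q (n - k) a * l ^ (k + 1) * h

/-- The sum over `k` in `A_4`: Taylor's formula for `q_n`, with
`C(n, k) (n - k) / (k + 1) = C(n, k + 1)`. -/
theorem sum_choose_mul_deriv_q (n : ℕ) (a l : ℝ) :
    ∑ k ∈ Finset.range n, (n.choose k : ℝ) *
      (((n - k : ℕ) : ℝ) / (k + 1) * (q (n - k - 1) a * l ^ (k + 1))) =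
      q n (a + l) + -1 * q n a := by
  rw [q_add n, Finset.sum_range_succ']
  simp only [pow_zero, Nat.sub_zero, Nat.choose_zero_right, Nat.cast_one, one_mul]
  rw [neg_one_mul, add_neg_cancel_right]
  refine Finset.sum_congr rfl fun k _ => ?_
  have h : (n.choose (k + 1) * (k + 1 : ℕ) : ℝ) = n.choose k * (n - k : ℕ) := by
    exact_mod_cast Nat.choose_succ_right_eq n k
  push_cast at h
  rw [Nat.sub_sub]
  field_simp
  linear_combination -q (n - (k + 1)) a * l ^ (k + 1) * h

theorem integrand₂_eq (n : ℕ) (x u : ℝ) : integrand₂ n x u =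
    ((Real.exp (-(x * u)) * q n (Real.log (u + 2) + Real.log u) / (u + 2) ^ 1 : ℝ) : ℂ) := by
  rw [integrand₂, eval_p, pow_one]
  push_cast
  rfl

theorem integrand₃_eq (n k : ℕ) (x u : ℝ) : integrand₃ n k x u =
    Real.exp (-(x * u)) * (1 / (k + 1) * (q (n - k) (Real.log (u + 2)) * Real.log u ^ (k + 1))) /
      (u + 2) ^ 0 := by
  rw [integrand₃, one_div_mul_f, Complex.ofReal_re]
  ring

theorem integrand₄_eq (n k : ℕ) (x : ℝ) {u : ℝ} (hu : 0 < u) : integrand₄ n k x u =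
    Real.exp (-(x * u)) * (((n - k : ℕ) : ℝ) / (k + 1) *
      (q (n - k - 1) (Real.log (u + 2)) * Real.log u ^ (k + 1))) / (u + 2) ^ 1 := by
  rw [integrand₄, deriv_f n k hu]
  ring

theorem logComb₃ {n k : ℕ} (hk : k < n) :
    LogComb n fun a l => 1 / (k + 1) * (q (n - k) a * l ^ (k + 1)) :=
  (LogComb.q_mul_pow (by omega) (by omega)).const_mul _

theorem logComb₄ {n k : ℕ} (hk : k < n) :
    LogComb n fun a l => ((n - k : ℕ) : ℝ) / (k + 1) * (q (n - k - 1) a * l ^ (k + 1)) :=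
  (LogComb.q_mul_pow (by omega) (by omega)).const_mul _

theorem integrableOn_integrand₂ (n : ℕ) {x : ℝ} (hx : 0 < x) :
    IntegrableOn (integrand₂ n x) (Ioi 0) := by
  have h := (LogComb.q_add (le_refl n)).integrableOn 1 hx
  exact (Integrable.ofReal h).congr (Eventually.of_forall fun _ => (integrand₂_eq n x _).symm)

theorem integrableOn_integrand₃ {n k : ℕ} (hk : k < n) {x : ℝ} (hx : 0 < x) :
    IntegrableOn (integrand₃ n k x) (Ioi 0) :=
  ((logComb₃ hk).integrableOn 0 hx).congr_fun (fun u _ => (integrand₃_eq n k x u).symm)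
    measurableSet_Ioi

theorem integrableOn_integrand₄ {n k : ℕ} (hk : k < n) {x : ℝ} (hx : 0 < x) :
    IntegrableOn (integrand₄ n k x) (Ioi 0) :=
  ((logComb₄ hk).integrableOn 1 hx).congr_fun (fun _ hu => (integrand₄_eq n k x hu).symm)
    measurableSet_Ioi

theorem A₂_eq (n : ℕ) (x : ℝ) :
    A₂ n x = ((-1 * logLaplace (fun a l => q n (a + l)) 1 x : ℝ) : ℂ) := by
  simp only [A₂, integrand₂_eq, logLaplace]
  rw [integral_complex_ofReal]
  simp

theorem A₃_eq (n : ℕ) {x : ℝ} (hx : 0 < x) :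
    A₃ n x = x * logLaplace (fun a l => ∑ k ∈ Finset.range n,
      (n.choose k : ℝ) * (1 / (k + 1) * (q (n - k) a * l ^ (k + 1)))) 0 x := by
  rw [logLaplace_sum (fun k hk => (logComb₃ hk).const_mul _) 0 hx, A₃]
  simp only [logLaplace_const_mul _ (Nat.choose n _ : ℝ), integrand₃_eq]
  rfl

theorem A₄_eq (n : ℕ) {x : ℝ} (hx : 0 < x) :
    A₄ n x = -1 * logLaplace (fun a l => ∑ k ∈ Finset.range n,
      (n.choose k : ℝ) * (((n - k : ℕ) : ℝ) / (k + 1) * (q (n - k - 1) a * l ^ (k + 1)))) 1 x := by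
  rw [logLaplace_sum (fun k hk => (logComb₄ hk).const_mul _) 1 hx, A₄, neg_one_mul]
  simp only [logLaplace_const_mul _ (Nat.choose n _ : ℝ)]
  congr 1
  refine Finset.sum_congr rfl fun k _ => ?_
  rw [logLaplace, setIntegral_congr_fun measurableSet_Ioi fun u hu => integrand₄_eq n k x hu]

/-- `A_2`, `A_3` and `A_4` are linear combinations of the integrals `U[a, b, ε]`. -/
theorem exists_coefficients (n : ℕ) : ∃ c₂ c₃ c₄ : ℕ → ℕ → ℝ, ∀ x : ℝ, 0 < x →
    A₂ n x = ((∑ a ∈ Finset.range (n + 1), ∑ b ∈ Finset.range (n + 1),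
      c₂ a b * U a b 1 x : ℝ) : ℂ) ∧
    A₃ n x = x * ∑ a ∈ Finset.range (n + 1), ∑ b ∈ Finset.range (n + 1), c₃ a b * U a b 0 x ∧
    A₄ n x = ∑ a ∈ Finset.range (n + 1), ∑ b ∈ Finset.range (n + 1), c₄ a b * U a b 1 x := by
  obtain ⟨c₂, h₂⟩ := ((LogComb.q_add (le_refl n)).const_mul (-1)).exists_logLaplace_eq 1
  obtain ⟨c₃, h₃⟩ := (LogComb.sum fun k (hk : k < n) =>
    (logComb₃ hk).const_mul (n.choose k)).exists_logLaplace_eq 0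
  obtain ⟨c₄, h₄⟩ := ((LogComb.sum fun k (hk : k < n) =>
    (logComb₄ hk).const_mul (n.choose k)).const_mul (-1)).exists_logLaplace_eq 1
  refine ⟨c₂, c₃, c₄, fun x hx => ⟨?_, ?_, ?_⟩⟩
  · rw [A₂_eq, ← logLaplace_const_mul, h₂ x hx]
  · rw [A₃_eq n hx, h₃ x hx]
  · rw [A₄_eq n hx, ← logLaplace_const_mul, h₄ x hx]

/-- Integration by parts against `e^(-x u)`; it cancels the terms of `A_3` and `A_4` without
`log u` against `A_1`. -/
theorem mul_logLaplace_q (n : ℕ) {x : ℝ} (hx : 0 < x) :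
    x * logLaplace (fun a _ => q (n + 1) a) 0 x =
      q (n + 1) (Real.log 2) + (n + 1) * logLaplace (fun a _ => q n a) 1 x := by
  have h₀ : IntegrableOn (fun u : ℝ => Real.exp (-(x * u)) * q (n + 1) (Real.log (u + 2)))
      (Ioi 0) := by
    have h := (LogComb.q_mul_pow (le_refl (n + 1)) (Nat.zero_le _)).integrableOn 0 hx
    simpa using h
  have h₁ : IntegrableOn (fun u : ℝ => Real.exp (-(x * u)) * q n (Real.log (u + 2)) / (u + 2))
      (Ioi 0) := by
    have h := (LogComb.q_mul_pow (le_refl n) (Nat.zero_le _)).integrableOn 1 hx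
    simpa using h
  have hd : ∀ u ∈ Ici (0 : ℝ), HasDerivAt
      (fun u : ℝ => Real.exp (-(x * u)) * q (n + 1) (Real.log (u + 2)))
      ((n + 1) * (Real.exp (-(x * u)) * q n (Real.log (u + 2)) / (u + 2)) -
        x * (Real.exp (-(x * u)) * q (n + 1) (Real.log (u + 2)))) u := by
    intro u hu
    have hu : (0 : ℝ) ≤ u := hu
    have h1 : HasDerivAt (fun v : ℝ => Real.log (v + 2)) (1 / (u + 2)) u :=
      ((hasDerivAt_id u).add_const 2).log (by positivity)
    have h2 := (hasDerivAt_q (n + 1) (Real.log (u + 2))).comp u h1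
    have h3 : HasDerivAt (fun u : ℝ => Real.exp (-(x * u))) (Real.exp (-(x * u)) * -(x * 1)) u :=
      (((hasDerivAt_id u).const_mul x).neg).exp
    refine (h3.mul h2).congr_deriv ?_
    simp only [Function.comp_apply, Nat.add_sub_cancel]
    push_cast
    ring
  have hi := (h₁.const_mul (n + 1 : ℝ)).sub (h₀.const_mul x)
  have ht := tendsto_zero_of_hasDerivAt_of_integrableOn_Ioi
    (fun u hu => hd u (mem_Ici_of_Ioi hu)) hi h₀
  have h := integral_Ioi_of_hasDerivAt_of_tendsto' hd hi ht
  rw [integral_sub (h₁.const_mul _) (h₀.const_mul _), integral_const_mul, integral_const_mul] at h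
  simp only [mul_zero, neg_zero, Real.exp_zero, one_mul, zero_add] at h
  simp only [logLaplace, pow_zero, pow_one, div_one]
  linarith

/-- The sum `A_1 + A_2 + A_3 + A_4` after the cancellation: only `q` at
`log (u + 2) + log u` remains. -/
noncomputable def totalSum (n : ℕ) (x : ℝ) : ℝ :=
  x / (n + 1) * logLaplace (fun a l => q (n + 1) (a + l)) 0 x -
    2 * logLaplace (fun a l => q n (a + l)) 1 x

theorem sum_A_eq (n : ℕ) {x : ℝ} (hx : 0 < x) :
    (A₁ n : ℂ) + A₂ n x + (A₃ n x : ℂ) + (A₄ n x : ℂ) = (totalSum n x : ℂ) := by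
  have hc : ∀ m, LogComb m fun a _ => q m a := fun m => by
    simpa using LogComb.q_mul_pow (le_refl m) (Nat.zero_le m)
  have h3 : A₃ n x = x * (1 / (n + 1) * (logLaplace (fun a l => q (n + 1) (a + l)) 0 x +
      -1 * logLaplace (fun a _ => q (n + 1) a) 0 x)) := by
    rw [A₃_eq n hx]
    simp only [sum_choose_mul_q]
    rw [logLaplace_const_mul, logLaplace_add (LogComb.q_add le_rfl) ((hc _).const_mul _) 0 hx,
      logLaplace_const_mul]
  have h4 : A₄ n x = -1 * (logLaplace (fun a l => q n (a + l)) 1 x +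
      -1 * logLaplace (fun a _ => q n a) 1 x) := by
    rw [A₄_eq n hx]
    simp only [sum_choose_mul_deriv_q]
    rw [logLaplace_add (LogComb.q_add le_rfl) ((hc _).const_mul _) 1 hx, logLaplace_const_mul]
  have h := mul_logLaplace_q n hx
  rw [A₂_eq, h3, h4, A₁_eq, totalSum]
  norm_cast
  have hn : (n + 1 : ℝ) ≠ 0 := by positivity
  push_cast
  field_simp
  linarith

theorem totalSum_zero {x : ℝ} (hx : 0 < x) : totalSum 0 x = 1 := by
  have h := integral_exp_mul_Ioi (neg_neg_of_pos hx) 0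
  have : (fun u => Real.exp (-x * u)) = fun u => Real.exp (-(x * u)) := by simp
  rw [this] at h
  simp [totalSum, logLaplace, q_one, q_zero, h, hx.ne']

/-! ### Logarithmic bounds in the first quadrant -/

theorem norm_log_pow_le (m : ℕ) {w : ℂ} (hw : w ≠ 0) :
    ‖Complex.log w‖ ^ m ≤ (m.factorial * 4 ^ m * Real.exp (Real.pi / 4)) *
      (‖w‖ ^ (1 / 4 : ℝ) + ‖w‖ ^ (-(1 / 4) : ℝ)) := by
  have hn : 0 < ‖w‖ := norm_pos_iff.2 hw
  have h0 : ‖Complex.log w‖ ≤ |Real.log ‖w‖| + Real.pi := by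
    refine (Complex.norm_le_abs_re_add_abs_im _).trans ?_
    rw [Complex.log_re, Complex.log_im]
    gcongr
    exact Complex.abs_arg_le_pi w
  have h1 := Real.pow_div_factorial_le_exp (‖Complex.log w‖ / 4) (by positivity) m
  have h2 := exp_abs_log_div_four_le hn
  have h3 : Real.exp (‖Complex.log w‖ / 4) ≤
      Real.exp (Real.pi / 4) * (‖w‖ ^ (1 / 4 : ℝ) + ‖w‖ ^ (-(1 / 4) : ℝ)) := by
    refine le_trans ?_ (mul_le_mul_of_nonneg_left h2 (Real.exp_pos _).le)
    rw [← Real.exp_add]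
    gcongr
    linarith
  have h4 := h1.trans h3
  rw [div_pow, div_div, div_le_iff₀ (by positivity)] at h4
  linarith

theorem one_le_rpow_add_rpow_neg {t : ℝ} (ht : 0 < t) :
    1 ≤ t ^ (1 / 4 : ℝ) + t ^ (-(1 / 4) : ℝ) := by
  rcases le_total 1 t with h | h
  · exact (Real.one_le_rpow h (by norm_num)).trans (le_add_of_nonneg_right (by positivity))
  · exact (Real.one_le_rpow_of_pos_of_le_one_of_nonpos ht h (by norm_num)).trans
      (le_add_of_nonneg_left (by positivity))

/-- The holomorphic branch of `log (1 + z^2)` on the right half plane. -/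
noncomputable def logSq (z : ℂ) : ℂ := Complex.log (1 + z ^ 2)

theorem one_add_sq_mem_slitPlane {z : ℂ} (hz : 0 < z.re) : 1 + z ^ 2 ∈ Complex.slitPlane := by
  rw [Complex.mem_slitPlane_iff]
  by_cases h : z.im = 0
  · left
    simp only [sq, Complex.add_re, Complex.one_re, Complex.mul_re, h]
    nlinarith
  · right
    simp only [sq, Complex.add_im, Complex.one_im, Complex.mul_im]
    have : z.re * z.im ≠ 0 := mul_ne_zero hz.ne' h
    intro h'
    apply this
    linarith

theorem one_add_sq_eq_mul (z : ℂ) : 1 + z ^ 2 = (z - Complex.I) * (z + Complex.I) := by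
  linear_combination Complex.I_sq

theorem one_le_norm_add_I {z : ℂ} (hz : 0 ≤ z.im) : 1 ≤ ‖z + Complex.I‖ := by
  have h := Complex.abs_im_le_norm (z + Complex.I)
  simp only [Complex.add_im, Complex.I_im] at h
  exact (le_trans (by linarith) (le_abs_self _)).trans h

theorem add_I_ne_zero {z : ℂ} (hz : 0 ≤ z.im) : z + Complex.I ≠ 0 :=
  norm_pos_iff.1 (one_pos.trans_le (one_le_norm_add_I hz))

theorem abs_im_sub_one_le {z : ℂ} (hz : 0 ≤ z.im) : |z.im - 1| ≤ ‖1 + z ^ 2‖ := by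
  have h := Complex.abs_im_le_norm (z - Complex.I)
  simp only [Complex.sub_im, Complex.I_im] at h
  rw [one_add_sq_eq_mul, norm_mul]
  exact h.trans (le_mul_of_one_le_right (norm_nonneg _) (one_le_norm_add_I hz))

theorem re_le_norm_one_add_sq {z : ℂ} (hz : 0 ≤ z.im) : z.re ≤ ‖1 + z ^ 2‖ := by
  have h := Complex.re_le_norm (z - Complex.I)
  simp only [Complex.sub_re, Complex.I_re, sub_zero] at h
  rw [one_add_sq_eq_mul, norm_mul]
  exact h.trans (le_mul_of_one_le_right (norm_nonneg _) (one_le_norm_add_I hz))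

theorem norm_one_add_sq_le {z : ℂ} (h0 : 0 ≤ z.re) (h1 : z.re ≤ 1) (hz : 0 ≤ z.im) :
    ‖1 + z ^ 2‖ ≤ (|z.im - 1| + 3) ^ 2 := by
  have h := Complex.norm_le_abs_re_add_abs_im (z - Complex.I)
  have h' := Complex.norm_le_abs_re_add_abs_im (z + Complex.I)
  simp only [Complex.sub_re, Complex.sub_im, Complex.add_re, Complex.add_im, Complex.I_re,
    Complex.I_im, sub_zero, add_zero, abs_of_nonneg h0] at h h'
  rw [abs_of_nonneg (by linarith : 0 ≤ z.im + 1)] at h'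
  have h2 := le_abs_self (z.im - 1)
  rw [one_add_sq_eq_mul, norm_mul, sq]
  gcongr <;> linarith

/-- The growth constant in the bounds for `|log (1 + z^2)|^m`. -/
noncomputable def logConst (m : ℕ) : ℝ := m.factorial * 4 ^ m * Real.exp (Real.pi / 4)

theorem logConst_nonneg (m : ℕ) : 0 ≤ logConst m := by unfold logConst; positivity

/-- Near the imaginary axis, `e^(-x Im z) |log (1 + z^2)|^m` is dominated by an integrable function
of `Im z` alone, uniformly in `Re z`. -/
theorem exp_mul_norm_logSq_pow_le (m : ℕ) {x : ℝ} (hx : 0 < x) {z : ℂ} (h0 : 0 ≤ z.re)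
    (h1 : z.re ≤ 1) (hz : 0 ≤ z.im) (hz1 : z.im ≠ 1) :
    Real.exp (-(x * z.im)) * ‖logSq z‖ ^ m ≤
      (2 * Real.exp x * logConst m) * logMajorant x (z.im - 1) := by
  have ht : 0 < |z.im - 1| := abs_pos.2 (sub_ne_zero.2 hz1)
  have hw := abs_im_sub_one_le hz
  have hw0 : 0 < ‖1 + z ^ 2‖ := ht.trans_le hw
  have hlog := norm_log_pow_le m (norm_pos_iff.1 hw0)
  have hs := one_le_rpow_add_rpow_neg ht
  set t := |z.im - 1| with ht_def
  set s := t ^ (1 / 4 : ℝ) + t ^ (-(1 / 4) : ℝ) with hs_def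
  have e1 : ‖1 + z ^ 2‖ ^ (1 / 4 : ℝ) ≤ t + 3 := by
    calc ‖1 + z ^ 2‖ ^ (1 / 4 : ℝ) ≤ ((t + 3) ^ 2) ^ (1 / 4 : ℝ) :=
          Real.rpow_le_rpow hw0.le (norm_one_add_sq_le h0 h1 hz) (by norm_num)
      _ = (t + 3) ^ (1 / 2 : ℝ) := by
          rw [← Real.rpow_natCast, ← Real.rpow_mul (by positivity)]; norm_num
      _ ≤ (t + 3) ^ (1 : ℝ) := Real.rpow_le_rpow_of_exponent_le (by linarith) (by norm_num)
      _ = t + 3 := Real.rpow_one _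
  have e2 : ‖1 + z ^ 2‖ ^ (-(1 / 4) : ℝ) ≤ s :=
    (Real.rpow_le_rpow_of_nonpos ht hw (by norm_num)).trans
      (le_add_of_nonneg_left (by positivity))
  have e3 : ‖1 + z ^ 2‖ ^ (1 / 4 : ℝ) + ‖1 + z ^ 2‖ ^ (-(1 / 4) : ℝ) ≤ 2 * ((t + 3) * s) := by
    nlinarith
  have e4 : Real.exp (-(x * z.im)) ≤ Real.exp x * Real.exp (-(x * t)) := by
    rw [← Real.exp_add]
    gcongr
    have : t ≤ z.im + 1 := by
      rw [ht_def, abs_le]; constructor <;> linarith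
    nlinarith
  calc _ ≤ (Real.exp x * Real.exp (-(x * t))) * (logConst m * (2 * ((t + 3) * s))) := by
        gcongr
        exact hlog.trans (mul_le_mul_of_nonneg_left e3 (logConst_nonneg m))
    _ = _ := by rw [logMajorant]; ring

/-- The holomorphic extension of the integrand `cos (x t) log^n (1 + t^2) / (1 + t^2)`. -/
noncomputable def g (n : ℕ) (x : ℝ) (z : ℂ) : ℂ :=
  Complex.exp (Complex.I * x * z) * logSq z ^ n / (1 + z ^ 2)

/-- The boundary term of the integration by parts that removes the pole at `i`. -/
noncomputable def B (n : ℕ) (x : ℝ) (z : ℂ) : ℂ :=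
  Complex.exp (Complex.I * x * z) * logSq z ^ (n + 1) / (n + 1)

/-- What remains after the integration by parts: it has only a logarithmic singularity at `i`. -/
noncomputable def h (n : ℕ) (x : ℝ) (z : ℂ) : ℂ :=
  -(Complex.exp (Complex.I * x * z) *
    (Complex.I * x * logSq z ^ (n + 1) / (n + 1) + 2 * logSq z ^ n / (z + Complex.I)))

theorem hasDerivAt_logSq {z : ℂ} (hz : 0 < z.re) :
    HasDerivAt logSq (2 * z / (1 + z ^ 2)) z := by
  have h1 : HasDerivAt (fun z : ℂ => 1 + z ^ 2) (2 * z) z := by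
    simpa using (hasDerivAt_pow 2 z).const_add 1
  exact h1.clog (one_add_sq_mem_slitPlane hz)

/-- The identity `2 i g = B' + h` behind the integration by parts, from
`2 i / (1 + z^2) = 2 z / (1 + z^2) - 2 / (z + i)`. -/
theorem hasDerivAt_B (n : ℕ) (x : ℝ) {z : ℂ} (hz : 0 < z.re) (hz' : 0 ≤ z.im) :
    HasDerivAt (B n x) (2 * Complex.I * g n x z - h n x z) z := by
  have h1 : HasDerivAt (fun z : ℂ => Complex.exp (Complex.I * x * z))
      (Complex.exp (Complex.I * x * z) * (Complex.I * x * 1)) z :=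
    ((hasDerivAt_id z).const_mul _).cexp
  have h2 := ((h1.mul ((hasDerivAt_logSq hz).fun_pow (n + 1))).div_const (n + 1 : ℂ))
  refine h2.congr_deriv ?_
  have hn : (n + 1 : ℂ) ≠ 0 := by exact_mod_cast n.succ_ne_zero
  have hw : 1 + z ^ 2 ≠ 0 := Complex.slitPlane_ne_zero (one_add_sq_mem_slitPlane hz)
  have hI := add_I_ne_zero hz'
  have key : 2 * Complex.I / (1 + z ^ 2) + 2 / (z + Complex.I) = 2 * z / (1 + z ^ 2) := by
    rw [one_add_sq_eq_mul] at hw ⊢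
    have := (mul_ne_zero_iff.1 hw).1
    field_simp
    ring
  rw [g, h, Nat.add_sub_cancel]
  push_cast
  have e : (n + 1 : ℂ) * logSq z ^ n * (2 * z / (1 + z ^ 2)) / (n + 1) =
      logSq z ^ n * (2 * z / (1 + z ^ 2)) := by
    field_simp
  rw [add_div, mul_div_assoc (Complex.exp (Complex.I * x * z)) ((n + 1 : ℂ) * _ * _), e, ← key]
  ring

theorem differentiableAt_g (n : ℕ) (x : ℝ) {z : ℂ} (hz : 0 < z.re) :
    DifferentiableAt ℂ (g n x) z := by
  have h1 := (hasDerivAt_logSq hz).differentiableAt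
  have hw : 1 + z ^ 2 ≠ 0 := Complex.slitPlane_ne_zero (one_add_sq_mem_slitPlane hz)
  unfold g
  exact DifferentiableAt.div (by fun_prop) (by fun_prop) hw

theorem norm_exp_I_mul (x : ℝ) (z : ℂ) :
    ‖Complex.exp (Complex.I * x * z)‖ = Real.exp (-(x * z.im)) := by
  rw [Complex.norm_exp]
  congr 1
  simp

theorem norm_h_le (n : ℕ) {x : ℝ} (hx : 0 < x) {z : ℂ} (h0 : 0 ≤ z.re)
    (h1 : z.re ≤ 1) (hz : 0 ≤ z.im) (hz1 : z.im ≠ 1) :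
    ‖h n x z‖ ≤ (x * (2 * Real.exp x * logConst (n + 1)) + 2 * (2 * Real.exp x * logConst n)) *
      logMajorant x (z.im - 1) := by
  have e1 := exp_mul_norm_logSq_pow_le (n + 1) hx h0 h1 hz hz1
  have e2 := exp_mul_norm_logSq_pow_le n hx h0 h1 hz hz1
  have hn : (1 : ℝ) ≤ ‖(n + 1 : ℂ)‖ := by
    rw [← Nat.cast_add_one, Complex.norm_natCast]; simp
  calc ‖h n x z‖ ≤ Real.exp (-(x * z.im)) * (x * ‖logSq z‖ ^ (n + 1) + 2 * ‖logSq z‖ ^ n) := by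
        rw [h, norm_neg, norm_mul, norm_exp_I_mul]
        gcongr
        refine (norm_add_le _ _).trans ?_
        gcongr
        · rw [norm_div, norm_mul, norm_mul, Complex.norm_I, one_mul, Complex.norm_real,
            Real.norm_of_nonneg hx.le, norm_pow]
          exact div_le_self (by positivity) hn
        · rw [norm_div, norm_mul, norm_pow, Complex.norm_two]
          exact div_le_self (by positivity) (one_le_norm_add_I hz)
    _ = x * (Real.exp (-(x * z.im)) * ‖logSq z‖ ^ (n + 1)) +
          2 * (Real.exp (-(x * z.im)) * ‖logSq z‖ ^ n) := by ring
    _ ≤ x * ((2 * Real.exp x * logConst (n + 1)) * logMajorant x (z.im - 1)) +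
          2 * ((2 * Real.exp x * logConst n) * logMajorant x (z.im - 1)) := by gcongr
    _ = _ := by ring

theorem norm_B_le (n : ℕ) {x : ℝ} (hx : 0 < x) {z : ℂ} (h0 : 0 ≤ z.re)
    (h1 : z.re ≤ 1) (hz : 0 ≤ z.im) (hz1 : z.im ≠ 1) :
    ‖B n x z‖ ≤ (2 * Real.exp x * logConst (n + 1)) * logMajorant x (z.im - 1) := by
  have hn : (1 : ℝ) ≤ ‖(n + 1 : ℂ)‖ := by
    rw [← Nat.cast_add_one, Complex.norm_natCast]; simp
  refine le_trans ?_ (exp_mul_norm_logSq_pow_le (n + 1) hx h0 h1 hz hz1)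
  rw [B, norm_div, norm_mul, norm_exp_I_mul, norm_pow]
  exact div_le_self (by positivity) hn

theorem norm_g_le (n : ℕ) {x : ℝ} (hx : 0 < x) {z : ℂ} (h0 : 0 < z.re)
    (h1 : z.re ≤ 1) (hz : 0 ≤ z.im) (hz1 : z.im ≠ 1) :
    ‖g n x z‖ ≤ (2 * Real.exp x * logConst n) * logMajorant x (z.im - 1) / z.re := by
  rw [g, norm_div, norm_mul, norm_exp_I_mul, norm_pow]
  have := exp_mul_norm_logSq_pow_le n hx h0.le h1 hz hz1
  have h2 := re_le_norm_one_add_sq hz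
  have h3 : 0 ≤ Real.exp (-(x * z.im)) * ‖logSq z‖ ^ n := by positivity
  exact div_le_div₀ (h3.trans this) this h0 h2

/-- Decay of `g` at infinity. -/
theorem norm_g_le_of_norm_ge (n : ℕ) {x : ℝ} (hx : 0 < x) {z : ℂ} (hz : 0 ≤ z.im) {R : ℝ}
    (hR : 2 ≤ R) (hzR : R ≤ ‖z‖) :
    ‖g n x z‖ ≤ 2 * logConst n * (R ^ 2 / 2) ^ (-(3 / 4) : ℝ) := by
  have hw : R ^ 2 / 2 ≤ ‖1 + z ^ 2‖ := by
    have h1 := norm_sub_le (1 + z ^ 2) 1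
    rw [add_sub_cancel_left, norm_pow, norm_one] at h1
    nlinarith [pow_le_pow_left₀ (by linarith) hzR 2]
  have hw1 : 1 ≤ ‖1 + z ^ 2‖ := by nlinarith
  have hw0 : 0 < ‖1 + z ^ 2‖ := by linarith
  have hlog := norm_log_pow_le n (norm_pos_iff.1 hw0)
  rw [g, norm_div, norm_mul, norm_exp_I_mul, norm_pow]
  have e1 : Real.exp (-(x * z.im)) ≤ 1 := by
    rw [Real.exp_le_one_iff]; nlinarith
  have e2 : ‖1 + z ^ 2‖ ^ (-(1 / 4) : ℝ) ≤ ‖1 + z ^ 2‖ ^ (1 / 4 : ℝ) :=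
    Real.rpow_le_rpow_of_exponent_le hw1 (by norm_num)
  calc _ ≤ 1 * (logConst n * (‖1 + z ^ 2‖ ^ (1 / 4 : ℝ) + ‖1 + z ^ 2‖ ^ (1 / 4 : ℝ))) /
        ‖1 + z ^ 2‖ := by
        gcongr
        exact hlog.trans (mul_le_mul_of_nonneg_left (by linarith) (logConst_nonneg n))
    _ = 2 * logConst n * ‖1 + z ^ 2‖ ^ (-(3 / 4) : ℝ) := by
        have : (-(3 / 4) : ℝ) = 1 / 4 - 1 := by norm_num
        rw [this, Real.rpow_sub_one hw0.ne']
        ring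
    _ ≤ _ := by
        have := logConst_nonneg n
        gcongr 2 * logConst n * ?_
        exact Real.rpow_le_rpow_of_nonpos (by positivity) hw (by norm_num)

/-! ### The contour integral -/

theorem logSq_ofReal (t : ℝ) : logSq t = (Real.log (t ^ 2 + 1) : ℂ) := by
  rw [logSq, Complex.ofReal_log (by positivity)]
  congr 1
  push_cast
  ring

theorem log_pow_div_le (n : ℕ) (t : ℝ) :
    Real.log (t ^ 2 + 1) ^ n / (t ^ 2 + 1) ≤
      2 * (n.factorial * 4 ^ n) * (1 + ‖t‖ ^ 2) ^ (-(3 / 2) / 2 : ℝ) := by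
  have h0 : 0 < t ^ 2 + 1 := by positivity
  have h1 : 1 ≤ t ^ 2 + 1 := by nlinarith
  have h := abs_log_pow_le n h0
  rw [abs_of_nonneg (Real.log_nonneg h1)] at h
  have e2 : (t ^ 2 + 1) ^ (-(1 / 4) : ℝ) ≤ (t ^ 2 + 1) ^ (1 / 4 : ℝ) :=
    Real.rpow_le_rpow_of_exponent_le h1 (by norm_num)
  have e3 : (-(3 / 2) / 2 : ℝ) = 1 / 4 - 1 := by norm_num
  rw [Real.norm_eq_abs, sq_abs, add_comm 1, e3, Real.rpow_sub_one h0.ne', div_le_iff₀ h0]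
  refine h.trans ?_
  field_simp
  linarith

theorem integrable_cos_mul_log_pow (n : ℕ) (x : ℝ) :
    Integrable fun t : ℝ => Real.cos (x * t) * Real.log (t ^ 2 + 1) ^ n / (t ^ 2 + 1) := by
  refine Integrable.mono' ((integrable_rpow_neg_one_add_norm_sq (E := ℝ) (μ := volume)
    (r := 3 / 2) (by norm_num)).const_mul (2 * (n.factorial * 4 ^ n))) ?_ ?_
  · exact Measurable.aestronglyMeasurable (by fun_prop)
  · refine Eventually.of_forall fun t => le_trans ?_ (log_pow_div_le n t)
    have h1 : 0 ≤ Real.log (t ^ 2 + 1) := Real.log_nonneg (by nlinarith)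
    rw [norm_div, norm_mul, Real.norm_of_nonneg (by positivity : 0 ≤ t ^ 2 + 1),
      Real.norm_of_nonneg (pow_nonneg h1 n)]
    gcongr
    exact mul_le_of_le_one_left (by positivity) (Real.abs_cos_le_one _)

theorem continuous_g_ofReal (n : ℕ) (x : ℝ) : Continuous fun t : ℝ => g n x t := by
  have h : ∀ t : ℝ, (t : ℂ) ^ 2 + 1 ≠ 0 := fun t => by
    have : (t ^ 2 + 1 : ℝ) ≠ 0 := by positivity
    exact_mod_cast this
  have h' : ∀ t : ℝ, 1 + (t : ℂ) ^ 2 ≠ 0 := fun t => by rw [add_comm]; exact h t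
  have hl : Continuous fun t : ℝ => Real.log (t ^ 2 + 1) :=
    Continuous.log (by fun_prop) fun t => by positivity
  simp only [g, logSq_ofReal]
  exact Continuous.div (by fun_prop) (by fun_prop) h'

theorem g_ofReal_re (n : ℕ) (x t : ℝ) : (g n x t).re =
    Real.cos (x * t) * Real.log (t ^ 2 + 1) ^ n / (t ^ 2 + 1) := by
  have e : g n x t = ((Real.log (t ^ 2 + 1) ^ n / (t ^ 2 + 1) : ℝ) : ℂ) *
      Complex.exp ((x * t : ℝ) * Complex.I) := by
    rw [g, logSq_ofReal]
    push_cast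
    rw [add_comm 1]
    ring_nf
  rw [e, Complex.re_ofReal_mul, Complex.exp_ofReal_mul_I_re]
  ring

theorem integrable_g_ofReal (n : ℕ) (x : ℝ) : Integrable fun t : ℝ => g n x t := by
  refine Integrable.mono' (integrable_cos_mul_log_pow n 0)
    (continuous_g_ofReal n x).aestronglyMeasurable (Eventually.of_forall fun t => ?_)
  have h1 : 0 ≤ Real.log (t ^ 2 + 1) := Real.log_nonneg (by nlinarith)
  rw [g, norm_div, norm_mul, norm_exp_I_mul, logSq_ofReal, norm_pow, Complex.norm_real,
    Real.norm_of_nonneg h1]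
  have : 1 + (t : ℂ) ^ 2 = ((t ^ 2 + 1 : ℝ) : ℂ) := by push_cast; ring
  rw [this, Complex.norm_real, Real.norm_of_nonneg (by positivity)]
  simp

theorem integrable_logMajorant_sub_one {x : ℝ} (hx : 0 < x) :
    Integrable fun y => logMajorant x (y - 1) :=
  (integrable_logMajorant hx).comp_sub_right 1

theorem vertical_re (d y : ℝ) : ((d : ℂ) + y * Complex.I).re = d := by simp

theorem vertical_im (d y : ℝ) : ((d : ℂ) + y * Complex.I).im = y := by simp

theorem ae_pos_ne_one : ∀ᵐ y ∂(volume.restrict (Ioi (0 : ℝ))), 0 < y ∧ y ≠ 1 := by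
  refine (ae_restrict_iff' measurableSet_Ioi).2 ?_
  filter_upwards [Measure.ae_ne volume (1 : ℝ)] with y hy h0 using ⟨h0, hy⟩

theorem continuous_logSq_vertical {d : ℝ} (hd : 0 < d) :
    Continuous fun y : ℝ => logSq (d + y * Complex.I) :=
  Continuous.clog (by fun_prop) fun y => one_add_sq_mem_slitPlane (by rwa [vertical_re])

theorem integrableOn_B_vertical (n : ℕ) {x : ℝ} (hx : 0 < x) {d : ℝ} (hd : 0 < d) (hd1 : d ≤ 1) :
    IntegrableOn (fun y : ℝ => B n x (d + y * Complex.I)) (Ioi 0) := by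
  refine Integrable.mono' ((integrable_logMajorant_sub_one hx).integrableOn.const_mul
    (2 * Real.exp x * logConst (n + 1))) ?_ ?_
  · have := continuous_logSq_vertical hd
    unfold B
    exact Continuous.aestronglyMeasurable (by fun_prop)
  · filter_upwards [ae_pos_ne_one] with y hy
    have h := norm_B_le n hx (z := d + y * Complex.I) (by simpa using hd.le) (by simpa using hd1)
      (by simpa using hy.1.le) (by simpa using hy.2)
    simpa only [vertical_im] using h

theorem integrableOn_g_vertical (n : ℕ) {x : ℝ} (hx : 0 < x) {d : ℝ} (hd : 0 < d) (hd1 : d ≤ 1) :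
    IntegrableOn (fun y : ℝ => g n x (d + y * Complex.I)) (Ioi 0) := by
  refine Integrable.mono' (((integrable_logMajorant_sub_one hx).integrableOn.const_mul
    (2 * Real.exp x * logConst n)).div_const d) ?_ ?_
  · have := continuous_logSq_vertical hd
    unfold g
    refine Continuous.aestronglyMeasurable (Continuous.div (by fun_prop) (by fun_prop) fun y => ?_)
    exact Complex.slitPlane_ne_zero (one_add_sq_mem_slitPlane (by rwa [vertical_re]))
  · filter_upwards [ae_pos_ne_one] with y hy
    have h := norm_g_le n hx (z := d + y * Complex.I) (by simpa using hd) (by simpa using hd1)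
      (by simpa using hy.1.le) (by simpa using hy.2)
    simpa only [vertical_im, vertical_re] using h

theorem measurable_h (n : ℕ) (x : ℝ) : Measurable (h n x) := by
  have : Measurable logSq := Complex.measurable_log.comp (by fun_prop)
  unfold h
  fun_prop

theorem norm_h_vertical_le (n : ℕ) {x : ℝ} (hx : 0 < x) {d y : ℝ} (hd : 0 ≤ d) (hd1 : d ≤ 1)
    (hy : 0 < y ∧ y ≠ 1) : ‖h n x (d + y * Complex.I)‖ ≤
      (x * (2 * Real.exp x * logConst (n + 1)) + 2 * (2 * Real.exp x * logConst n)) *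
        logMajorant x (y - 1) := by
  have h := norm_h_le n hx (z := d + y * Complex.I) (by simpa using hd) (by simpa using hd1)
    (by simpa using hy.1.le) (by simpa using hy.2)
  simpa only [vertical_im] using h

theorem integrableOn_h_vertical (n : ℕ) {x : ℝ} (hx : 0 < x) {d : ℝ} (hd : 0 ≤ d) (hd1 : d ≤ 1) :
    IntegrableOn (fun y : ℝ => h n x (d + y * Complex.I)) (Ioi 0) := by
  refine Integrable.mono' ((integrable_logMajorant_sub_one hx).integrableOn.const_mul
    (x * (2 * Real.exp x * logConst (n + 1)) + 2 * (2 * Real.exp x * logConst n)))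
    ((measurable_h n x).comp (by fun_prop)).aestronglyMeasurable ?_
  filter_upwards [ae_pos_ne_one] with y hy using norm_h_vertical_le n hx hd hd1 hy

/-- Integration by parts along a vertical line in the right half plane. -/
theorem integral_g_vertical (n : ℕ) {x : ℝ} (hx : 0 < x) {d : ℝ} (hd : 0 < d) (hd1 : d ≤ 1) :
    Complex.I * ∫ y in Ioi (0 : ℝ), g n x (d + y * Complex.I) =
      (1 / 2) * (Complex.I * B n x d + ∫ y in Ioi (0 : ℝ), h n x (d + y * Complex.I)) := by
  have hder : ∀ y ∈ Ici (0 : ℝ), HasDerivAt (fun y : ℝ => B n x (d + y * Complex.I))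
      (-2 * g n x (d + y * Complex.I) - Complex.I * h n x (d + y * Complex.I)) y := by
    intro y hy
    have hy : 0 ≤ y := hy
    have h1 : HasDerivAt (fun y : ℝ => (d : ℂ) + y * Complex.I) (1 * Complex.I) y :=
      ((Complex.ofRealCLM.hasDerivAt (x := y)).mul_const Complex.I).const_add _
    have h2 := (hasDerivAt_B n x (z := d + y * Complex.I) (by simpa using hd)
      (by simpa using hy)).scomp y h1
    refine h2.congr_deriv ?_
    rw [smul_eq_mul]
    linear_combination 2 * g n x (d + y * Complex.I) * Complex.I_sq
  have hg := (integrableOn_g_vertical n hx hd hd1).const_mul (-2)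
  have hh := (integrableOn_h_vertical n hx hd.le hd1).const_mul Complex.I
  have ht := tendsto_zero_of_hasDerivAt_of_integrableOn_Ioi
    (fun y hy => hder y (mem_Ici_of_Ioi hy)) (hg.sub hh) (integrableOn_B_vertical n hx hd hd1)
  have hi := integral_Ioi_of_hasDerivAt_of_tendsto' hder (hg.sub hh) ht
  rw [integral_sub hg hh, integral_const_mul, integral_const_mul] at hi
  simp only [Complex.ofReal_zero, zero_mul, add_zero] at hi
  linear_combination (-Complex.I / 2) * hi +
    (-1 / 2) * (∫ y in Ioi (0 : ℝ), h n x (d + y * Complex.I)) * Complex.I_sq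

theorem tendsto_mul_rpow (c : ℝ) :
    Tendsto (fun R : ℝ => 2 * c * (R ^ 2 / 2) ^ (-(3 / 4) : ℝ) * R) atTop (𝓝 0) := by
  have h := (tendsto_rpow_neg_atTop (y := 1 / 2) (by norm_num)).const_mul
    (2 * c / 2 ^ (-(3 / 4) : ℝ))
  rw [mul_zero] at h
  refine h.congr' ?_
  filter_upwards [eventually_gt_atTop 0] with R hR
  have e : (R ^ 2) ^ (-(3 / 4) : ℝ) * R = R ^ (-(1 / 2) : ℝ) := by
    rw [← Real.rpow_natCast, ← Real.rpow_mul hR.le, ← Real.rpow_add_one hR.ne']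
    norm_num
  rw [Real.div_rpow (by positivity) (by positivity), ← e]
  ring

/-- Cauchy's theorem: the half line `[d, ∞)` may be rotated to the vertical half line from `d`. -/
theorem integral_g_rotate (n : ℕ) {x : ℝ} (hx : 0 < x) {d : ℝ} (hd : 0 < d) (hd1 : d ≤ 1) :
    ∫ t in Ioi d, g n x t = Complex.I * ∫ y in Ioi (0 : ℝ), g n x (d + y * Complex.I) := by
  have hrect : ∀ R : ℝ, d < R → (∫ t in d..R, g n x t) - (∫ t in d..R, g n x (t + R * Complex.I)) +
      Complex.I * (∫ y in (0 : ℝ)..R, g n x (R + y * Complex.I)) -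
      Complex.I * (∫ y in (0 : ℝ)..R, g n x (d + y * Complex.I)) = 0 := by
    intro R hR
    have := Complex.integral_boundary_rect_eq_zero_of_differentiableOn (g n x) d
      (R + R * Complex.I) (fun z hz => (differentiableAt_g n x ?_).differentiableWithinAt)
    · simpa using this
    · have := (Complex.mem_reProdIm.1 hz).1
      simp only [Complex.ofReal_re, vertical_re, uIcc_of_le hR.le] at this
      exact hd.trans_le this.1
  -- The two far sides have length at most `R`, and `g = O(R ^ (-3 / 2))` there.
  have hsmall : ∀ F : ℝ → ℝ → ℂ, ∀ a : ℝ, 0 ≤ a → (∀ R t, 2 ≤ R → a ≤ t → t ≤ R →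
      ‖F R t‖ ≤ 2 * logConst n * (R ^ 2 / 2) ^ (-(3 / 4) : ℝ)) →
      Tendsto (fun R => ∫ t in a..R, F R t) atTop (𝓝 0) := by
    intro F a ha hF
    refine squeeze_zero_norm' ?_ (tendsto_mul_rpow (logConst n))
    filter_upwards [eventually_ge_atTop 2, eventually_ge_atTop a] with R hR haR
    have hb := intervalIntegral.norm_integral_le_of_norm_le_const (a := a) (b := R) (f := F R)
      (C := 2 * logConst n * (R ^ 2 / 2) ^ (-(3 / 4) : ℝ)) fun t ht => by
        rw [uIoc_of_le haR] at ht
        exact hF R t hR ht.1.le ht.2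
    refine hb.trans ?_
    have := logConst_nonneg n
    gcongr
    rw [abs_of_nonneg (by linarith)]
    linarith
  have htop := hsmall (fun R t => g n x (t + R * Complex.I)) d hd.le fun R t hR ht _ => by
    refine norm_g_le_of_norm_ge n hx (by rw [vertical_im]; linarith) hR ?_
    have := Complex.abs_im_le_norm ((t : ℂ) + R * Complex.I)
    rw [vertical_im] at this
    exact (le_abs_self R).trans this
  have hright := hsmall (fun R y => g n x (R + y * Complex.I)) 0 le_rfl fun R y hR hy _ => by
    refine norm_g_le_of_norm_ge n hx (by rwa [vertical_im]) hR ?_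
    have := Complex.re_le_norm ((R : ℂ) + y * Complex.I)
    rwa [vertical_re] at this
  have hbot := intervalIntegral_tendsto_integral_Ioi d (integrable_g_ofReal n x).integrableOn
    tendsto_id
  have hleft := intervalIntegral_tendsto_integral_Ioi 0 (integrableOn_g_vertical n hx hd hd1)
    tendsto_id
  have hlim := ((hbot.sub htop).add (hright.const_mul Complex.I)).sub
    (hleft.const_mul Complex.I)
  have h0 := tendsto_nhds_unique (hlim.congr' (by
    filter_upwards [eventually_gt_atTop d] with R hR
    exact hrect R hR)) tendsto_const_nhds
  linear_combination h0

theorem one_add_sq_mul_I (y : ℝ) : 1 + ((y : ℂ) * Complex.I) ^ 2 = ((1 - y ^ 2 : ℝ) : ℂ) := by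
  rw [mul_pow, Complex.I_sq]; push_cast; ring

/-- Convergence of `log (1 + z^2)` at the upper imaginary axis, from the right; beyond `i` the
limit is the value of the principal branch on its cut. -/
theorem tendsto_logSq_vertical {y : ℝ} (hy : 0 < y ∧ y ≠ 1) :
    Tendsto (fun d : ℝ => logSq (d + y * Complex.I)) (𝓝[>] 0) (𝓝 (logSq (y * Complex.I))) := by
  have hc : Tendsto (fun d : ℝ => 1 + ((d : ℂ) + y * Complex.I) ^ 2) (𝓝[>] 0)
      (𝓝 (1 + ((y : ℂ) * Complex.I) ^ 2)) := by
    have : Continuous fun d : ℝ => 1 + ((d : ℂ) + y * Complex.I) ^ 2 := by fun_prop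
    simpa using (this.tendsto 0).mono_left nhdsWithin_le_nhds
  have hre := one_add_sq_mul_I y
  unfold logSq
  rcases lt_or_gt_of_ne hy.2 with h | h
  · refine hc.clog ?_
    rw [hre, Complex.ofReal_mem_slitPlane]
    nlinarith
  · have h1 := Complex.continuousWithinAt_log_of_re_neg_of_im_zero
      (z := 1 + ((y : ℂ) * Complex.I) ^ 2) (by rw [hre, Complex.ofReal_re]; nlinarith)
      (by rw [hre, Complex.ofReal_im])
    refine h1.tendsto.comp (tendsto_nhdsWithin_iff.2 ⟨hc, ?_⟩)
    filter_upwards [self_mem_nhdsWithin] with d hd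
    have hd : 0 < d := hd
    have hy0 := hy.1
    change 0 ≤ (1 + ((d : ℂ) + y * Complex.I) ^ 2).im
    simp only [sq, Complex.add_im, Complex.one_im, Complex.mul_im, vertical_re]
    simp
    positivity

theorem tendsto_h_vertical (n : ℕ) (x : ℝ) {y : ℝ} (hy : 0 < y ∧ y ≠ 1) :
    Tendsto (fun d : ℝ => h n x (d + y * Complex.I)) (𝓝[>] 0) (𝓝 (h n x (y * Complex.I))) := by
  have hl := tendsto_logSq_vertical hy
  have hz : Tendsto (fun d : ℝ => (d : ℂ) + y * Complex.I) (𝓝[>] 0) (𝓝 (y * Complex.I)) := by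
    have : Continuous fun d : ℝ => (d : ℂ) + y * Complex.I := by fun_prop
    simpa using (this.tendsto 0).mono_left nhdsWithin_le_nhds
  have hI := add_I_ne_zero (z := y * Complex.I) (by simpa using hy.1.le)
  unfold h
  exact (((hz.const_mul _).cexp).mul (((((hl.pow (n + 1)).const_mul _).div_const _)).add
    (((hl.pow n).const_mul 2).div (hz.add_const _) hI))).neg

/-- The integral of `g` over the positive real axis equals half the integral of `h` over the
positive imaginary axis. -/
theorem integral_g_eq (n : ℕ) {x : ℝ} (hx : 0 < x) :
    ∫ t in Ioi (0 : ℝ), g n x t = (1 / 2) * ∫ y in Ioi (0 : ℝ), h n x (y * Complex.I) := by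
  have hev : ∀ᶠ d : ℝ in 𝓝[>] 0, 0 < d ∧ d ≤ 1 := Ioc_mem_nhdsGT one_pos
  have hid : ∀ᶠ d : ℝ in 𝓝[>] 0, (1 / 2) * (Complex.I * B n x d +
      ∫ y in Ioi (0 : ℝ), h n x (d + y * Complex.I)) =
      (∫ t in Ioi (0 : ℝ), g n x t) - ∫ t in (0 : ℝ)..d, g n x t := by
    filter_upwards [hev] with d hd
    rw [← integral_g_vertical n hx hd.1 hd.2, ← integral_g_rotate n hx hd.1 hd.2]
    rw [← intervalIntegral.integral_Ioi_sub_Ioi (integrable_g_ofReal n x).integrableOn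
      hd.1.le]
    ring
  have hr : Tendsto (fun d : ℝ => (∫ t in Ioi (0 : ℝ), g n x t) - ∫ t in (0 : ℝ)..d, g n x t)
      (𝓝[>] 0) (𝓝 (∫ t in Ioi (0 : ℝ), g n x t)) := by
    have hc := intervalIntegral.continuous_primitive
      (fun a b => (continuous_g_ofReal n x).intervalIntegrable (μ := volume) a b) 0
    have := (hc.tendsto 0).mono_left (nhdsWithin_le_nhds (s := Ioi 0))
    simpa using this.const_sub (∫ t in Ioi (0 : ℝ), g n x t)
  have hB : Tendsto (fun d : ℝ => B n x d) (𝓝[>] 0) (𝓝 0) := by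
    have hl : Continuous fun t : ℝ => Real.log (t ^ 2 + 1) :=
      Continuous.log (by fun_prop) fun t => by positivity
    have hc : Continuous fun d : ℝ => B n x d := by
      simp only [B, logSq_ofReal]
      fun_prop
    have := (hc.tendsto 0).mono_left (nhdsWithin_le_nhds (s := Ioi 0))
    simpa [B, logSq] using this
  have hh : Tendsto (fun d : ℝ => ∫ y in Ioi (0 : ℝ), h n x (d + y * Complex.I)) (𝓝[>] 0)
      (𝓝 (∫ y in Ioi (0 : ℝ), h n x (y * Complex.I))) := by
    refine tendsto_integral_filter_of_dominated_convergence _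
      (Eventually.of_forall fun d =>
        ((measurable_h n x).comp (by fun_prop)).aestronglyMeasurable) ?_
      ((integrable_logMajorant_sub_one hx).integrableOn.const_mul
        (x * (2 * Real.exp x * logConst (n + 1)) + 2 * (2 * Real.exp x * logConst n))) ?_
    · filter_upwards [hev] with d hd
      filter_upwards [ae_pos_ne_one] with y hy using norm_h_vertical_le n hx hd.1.le hd.2 hy
    · filter_upwards [ae_pos_ne_one] with y hy using tendsto_h_vertical n x hy
  have hl := ((hB.const_mul Complex.I).add hh).const_mul (1 / 2)
  rw [mul_zero, zero_add] at hl
  exact tendsto_nhds_unique hr (hl.congr' hid)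

/-! ### The value of the integral -/

theorem h_mul_I_re (n : ℕ) (x y : ℝ) : (h n x (y * Complex.I)).re =
    Real.exp (-(x * y)) * (x / (n + 1) * (logSq (y * Complex.I) ^ (n + 1)).im -
      2 / (y + 1) * (logSq (y * Complex.I) ^ n).im) := by
  have e1 : Complex.exp (Complex.I * x * (y * Complex.I)) = (Real.exp (-(x * y)) : ℂ) := by
    push_cast
    congr 1
    linear_combination (x * y : ℂ) * Complex.I_sq
  have e2 : Complex.I * x * logSq (y * Complex.I) ^ (n + 1) / (n + 1) =
      ((x / (n + 1) : ℝ) : ℂ) * (Complex.I * logSq (y * Complex.I) ^ (n + 1)) := by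
    push_cast; ring
  have e3 : 2 * logSq (y * Complex.I) ^ n / (y * Complex.I + Complex.I) =
      ((-2 / (y + 1) : ℝ) : ℂ) * (Complex.I * logSq (y * Complex.I) ^ n) := by
    rw [← add_one_mul, div_mul_eq_div_div, Complex.div_I]
    push_cast
    ring
  rw [h, e1, e2, e3, Complex.neg_re, Complex.re_ofReal_mul, Complex.add_re, Complex.re_ofReal_mul,
    Complex.re_ofReal_mul, Complex.I_mul_re, Complex.I_mul_re]
  ring

theorem h_mul_I_re_of_le_one (n : ℕ) (x : ℝ) {y : ℝ} (h0 : 0 < y) (h1 : y ≤ 1) :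
    (h n x (y * Complex.I)).re = 0 := by
  have e : logSq (y * Complex.I) = (Real.log (1 - y ^ 2) : ℂ) := by
    rw [logSq, one_add_sq_mul_I, Complex.ofReal_log (by nlinarith)]
  rw [h_mul_I_re, e, ← Complex.ofReal_pow, ← Complex.ofReal_pow, Complex.ofReal_im,
    Complex.ofReal_im]
  ring

theorem logSq_mul_I_of_one_lt {u : ℝ} (hu : 0 < u) :
    logSq (((u + 1 : ℝ) : ℂ) * Complex.I) =
      ((Real.log (u + 2) + Real.log u : ℝ) : ℂ) + Real.pi * Complex.I := by
  have e : (1 - (u + 1) ^ 2 : ℝ) = -((u + 2) * u) := by ring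
  have hneg : -((u + 2) * u) < 0 := by nlinarith
  rw [logSq, one_add_sq_mul_I, e, Complex.log, Complex.arg_ofReal_of_neg hneg, Complex.norm_real,
    norm_neg, Real.norm_of_nonneg (by positivity), Real.log_mul (by positivity) hu.ne']

theorem h_mul_I_re_of_one_lt (n : ℕ) (x : ℝ) {u : ℝ} (hu : 0 < u) :
    (h n x (((u + 1 : ℝ) : ℂ) * Complex.I)).re =
      (Real.pi * Real.exp (-x)) *
        (x / (n + 1) * (Real.exp (-(x * u)) *
          q (n + 1) (Real.log (u + 2) + Real.log u) / (u + 2) ^ 0) -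
        2 * (Real.exp (-(x * u)) * q n (Real.log (u + 2) + Real.log u) / (u + 2) ^ 1)) := by
  have hq : ∀ m, (logSq (((u + 1 : ℝ) : ℂ) * Complex.I) ^ m).im =
      Real.pi * q m (Real.log (u + 2) + Real.log u) := by
    intro m
    rw [logSq_mul_I_of_one_lt hu, q, mul_div_cancel₀ _ Real.pi_ne_zero]
  have e : Real.exp (-(x * (u + 1))) = Real.exp (-x) * Real.exp (-(x * u)) := by
    rw [← Real.exp_add]; congr 1; ring
  have e2 : u + 1 + 1 = u + 2 := by ring
  rw [h_mul_I_re, hq, hq, e, e2]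
  ring

/-- The closed form of the first expression of the derivative, with the sum of the four terms
`A_j` in the form of `totalSum`. -/
theorem integral_cos_mul_log_pow (n : ℕ) {x : ℝ} (hx : 0 < x) :
    ∫ u in Ioi (0 : ℝ), Real.cos (x * u) * Real.log (u ^ 2 + 1) ^ n / (u ^ 2 + 1) =
      Real.pi / 2 * Real.exp (-x) * totalSum n x := by
  have hint : IntegrableOn (fun y : ℝ => h n x (y * Complex.I)) (Ioi 0) := by
    simpa using integrableOn_h_vertical n hx le_rfl zero_le_one
  have h1 : ∫ u in Ioi (0 : ℝ), Real.cos (x * u) * Real.log (u ^ 2 + 1) ^ n / (u ^ 2 + 1) =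
      (∫ t in Ioi (0 : ℝ), g n x t).re := by
    simp only [← g_ofReal_re]
    exact integral_re (integrable_g_ofReal n x).integrableOn
  have h2 : (∫ t in Ioi (0 : ℝ), g n x t).re =
      1 / 2 * ∫ y in Ioi (0 : ℝ), (h n x (y * Complex.I)).re := by
    have e : (1 / 2 : ℂ) = ((1 / 2 : ℝ) : ℂ) := by norm_num
    rw [integral_g_eq n hx, e, Complex.re_ofReal_mul]
    congr 1
    exact (integral_re hint).symm
  have h3 : ∫ y in Ioi (0 : ℝ), (h n x (y * Complex.I)).re =
      ∫ y in Ioi (1 : ℝ), (h n x (y * Complex.I)).re := by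
    refine setIntegral_eq_of_subset_of_forall_sdiff_eq_zero measurableSet_Ioi
      (Ioi_subset_Ioi zero_le_one) fun y hy => ?_
    exact h_mul_I_re_of_le_one n x hy.1 (not_lt.1 hy.2)
  have h4 : ∫ y in Ioi (1 : ℝ), (h n x (y * Complex.I)).re =
      ∫ u in Ioi (0 : ℝ), (h n x (((u + 1 : ℝ) : ℂ) * Complex.I)).re := by
    have := (measurePreserving_add_right volume (1 : ℝ)).setIntegral_preimage_emb
      (MeasurableEquiv.addRight (1 : ℝ)).measurableEmbedding
      (fun y : ℝ => (h n x (y * Complex.I)).re) (Ioi 1)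
    rw [← this]
    simp
  have i1 := (LogComb.q_add (le_refl (n + 1))).integrableOn 0 hx
  have i2 := (LogComb.q_add (le_refl n)).integrableOn 1 hx
  rw [h1, h2, h3, h4, setIntegral_congr_fun measurableSet_Ioi
    fun u hu => h_mul_I_re_of_one_lt n x hu, integral_const_mul,
    integral_sub (i1.const_mul _) (i2.const_mul _), integral_const_mul, integral_const_mul,
    totalSum, logLaplace, logLaplace]
  ring

/-! ### Differentiation in the order -/

/-- `cos (x u) log^m (u^2 + 1) (u^2 + 1)^(-s - 1/2)`, which is `(-1)^m` times the `m`-th derivative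
in `s` of the integrand of `T`. The complex power is written as an exponential centred at
`s = 1/2`. -/
noncomputable def orderIntegrand (x : ℝ) (m : ℕ) (s : ℂ) (u : ℝ) : ℂ :=
  ((Real.cos (x * u) * Real.log (u ^ 2 + 1) ^ m / (u ^ 2 + 1) : ℝ) : ℂ) *
    Complex.exp (-(s - 1 / 2) * Real.log (u ^ 2 + 1))

theorem measurable_orderIntegrand (x : ℝ) (m : ℕ) (s : ℂ) : Measurable (orderIntegrand x m s) := by
  unfold orderIntegrand
  fun_prop

/-- For `|s - 1/2| < 1/8` the complex power costs a factor `(u^2 + 1)^(1/8)` and the logarithms cost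
`(u^2 + 1)^(1/4)`; the remaining exponent `-5/8` is still integrable. -/
theorem norm_orderIntegrand_le (x : ℝ) (m : ℕ) {s : ℂ} (hs : s ∈ Metric.ball (1 / 2 : ℂ) (1 / 8))
    (u : ℝ) : ‖orderIntegrand x m s u‖ ≤
      2 * (m.factorial * 4 ^ m) * (1 + ‖u‖ ^ 2) ^ (-(5 / 4) / 2 : ℝ) := by
  have h0 : 0 < u ^ 2 + 1 := by positivity
  have h1 : 0 ≤ Real.log (u ^ 2 + 1) := Real.log_nonneg (by nlinarith)
  have h2 := log_pow_div_le m u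
  rw [Real.norm_eq_abs, sq_abs, add_comm 1] at h2 ⊢
  have h3 : ‖Complex.exp (-(s - 1 / 2) * Real.log (u ^ 2 + 1))‖ ≤ (u ^ 2 + 1) ^ (1 / 8 : ℝ) := by
    rw [Complex.norm_exp, Complex.re_mul_ofReal, Real.rpow_def_of_pos h0, mul_comm (Real.log _)]
    gcongr
    rw [mem_ball_iff_norm, ← norm_neg] at hs
    exact (Complex.re_le_norm _).trans hs.le
  have h4 : ‖((Real.cos (x * u) * Real.log (u ^ 2 + 1) ^ m / (u ^ 2 + 1) : ℝ) : ℂ)‖ ≤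
      Real.log (u ^ 2 + 1) ^ m / (u ^ 2 + 1) := by
    rw [Complex.norm_real, norm_div, norm_mul, Real.norm_of_nonneg h0.le,
      Real.norm_of_nonneg (pow_nonneg h1 m)]
    gcongr
    exact mul_le_of_le_one_left (by positivity) (Real.abs_cos_le_one _)
  rw [orderIntegrand, norm_mul]
  calc _ ≤ (2 * (m.factorial * 4 ^ m) * (u ^ 2 + 1) ^ (-(3 / 2) / 2 : ℝ)) *
        (u ^ 2 + 1) ^ (1 / 8 : ℝ) := by
        gcongr
        exact h4.trans h2
    _ = _ := by
        rw [mul_assoc, ← Real.rpow_add h0]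
        norm_num

theorem integrable_orderBound (m : ℕ) : Integrable fun u : ℝ =>
    2 * (m.factorial * 4 ^ m) * (1 + ‖u‖ ^ 2) ^ (-(5 / 4) / 2 : ℝ) :=
  (integrable_rpow_neg_one_add_norm_sq (by norm_num)).const_mul _

theorem integrable_orderIntegrand (x : ℝ) (m : ℕ) {s : ℂ}
    (hs : s ∈ Metric.ball (1 / 2 : ℂ) (1 / 8)) : Integrable (orderIntegrand x m s) :=
  (integrable_orderBound m).mono' (measurable_orderIntegrand x m s).aestronglyMeasurable
    (Eventually.of_forall fun u => norm_orderIntegrand_le x m hs u)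

theorem hasDerivAt_integral_orderIntegrand (x : ℝ) (m : ℕ) {s : ℂ}
    (hs : s ∈ Metric.ball (1 / 2 : ℂ) (1 / 8)) :
    HasDerivAt (fun s => ∫ u in Ioi (0 : ℝ), orderIntegrand x m s u)
      (-∫ u in Ioi (0 : ℝ), orderIntegrand x (m + 1) s u) s := by
  have h := (hasDerivAt_integral_of_dominated_loc_of_deriv_le
    (μ := volume.restrict (Ioi (0 : ℝ))) (F := orderIntegrand x m)
    (F' := fun s u => -orderIntegrand x (m + 1) s u) (Metric.isOpen_ball.mem_nhds hs)
    (Eventually.of_forall fun s => (measurable_orderIntegrand x m s).aestronglyMeasurable)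
    (integrable_orderIntegrand x m hs).integrableOn
    (measurable_orderIntegrand x (m + 1) s).neg.aestronglyMeasurable
    (Eventually.of_forall fun u s hs => by
      rw [norm_neg]; exact norm_orderIntegrand_le x (m + 1) hs u)
    (integrable_orderBound (m + 1)).integrableOn
    (Eventually.of_forall fun u s _ => ?_)).2
  · rwa [integral_neg] at h
  · have h1 : HasDerivAt (fun s : ℂ => -(s - 1 / 2) * Real.log (u ^ 2 + 1))
        (-1 * Real.log (u ^ 2 + 1)) s :=
      (((hasDerivAt_id s).sub_const (1 / 2)).neg).mul_const _
    refine (h1.cexp.const_mul _).congr_deriv ?_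
    rw [orderIntegrand]
    push_cast
    ring

theorem integrand_eq_orderIntegrand (s : ℂ) (x u : ℝ) :
    (Real.cos (x * u) : ℂ) / ((u ^ 2 + 1 : ℝ) : ℂ) ^ (s + 1 / 2) = orderIntegrand x 0 s u := by
  have h0 : ((u ^ 2 + 1 : ℝ) : ℂ) ≠ 0 := by
    have : (u ^ 2 + 1 : ℝ) ≠ 0 := by positivity
    exact_mod_cast this
  have e : s + 1 / 2 = (s - 1 / 2) + 1 := by ring
  rw [e, Complex.cpow_add _ _ h0, Complex.cpow_one, Complex.cpow_def_of_ne_zero h0,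
    ← Complex.ofReal_log (by positivity), orderIntegrand, neg_mul, Complex.exp_neg,
    mul_comm (s - 1 / 2)]
  push_cast
  have := Complex.exp_ne_zero (Real.log (u ^ 2 + 1) * (s - 1 / 2))
  field_simp

theorem tendsto_partialT (x : ℝ) {s : ℂ} (hs : s ∈ Metric.ball (1 / 2 : ℂ) (1 / 8)) :
    Tendsto (fun R : ℝ => partialT s x R) atTop
      (𝓝 (∫ u in Ioi (0 : ℝ), orderIntegrand x 0 s u)) := by
  simp only [partialT, integrand_eq_orderIntegrand]
  exact intervalIntegral_tendsto_integral_Ioi 0 (integrable_orderIntegrand x 0 hs).integrableOn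
    tendsto_id

theorem T_eq (x : ℝ) {s : ℂ} (hs : s ∈ Metric.ball (1 / 2 : ℂ) (1 / 8)) :
    T s x = ∫ u in Ioi (0 : ℝ), orderIntegrand x 0 s u :=
  (tendsto_partialT x hs).limUnder_eq

theorem iteratedDeriv_T (x : ℝ) (m : ℕ) : ∀ s ∈ Metric.ball (1 / 2 : ℂ) (1 / 8),
    iteratedDeriv m (fun s : ℂ => T s x) s =
      (-1) ^ m * ∫ u in Ioi (0 : ℝ), orderIntegrand x m s u := by
  induction m with
  | zero => intro s hs; simp [T_eq x hs]
  | succ m ih =>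
    intro s hs
    have he : iteratedDeriv m (fun s : ℂ => T s x) =ᶠ[𝓝 s]
        fun s => (-1) ^ m * ∫ u in Ioi (0 : ℝ), orderIntegrand x m s u := by
      filter_upwards [Metric.isOpen_ball.mem_nhds hs] with s hs using ih s hs
    rw [iteratedDeriv_succ, he.deriv_eq,
      ((hasDerivAt_integral_orderIntegrand x m hs).const_mul _).deriv]
    ring

theorem contDiffAt_T (x : ℝ) (n : ℕ) : ContDiffAt ℂ n (fun s : ℂ => T s x) (1 / 2) := by
  have h : DifferentiableOn ℂ (fun s : ℂ => T s x) (Metric.ball (1 / 2 : ℂ) (1 / 8)) := by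
    refine DifferentiableOn.congr (fun s hs => ?_) fun s hs => T_eq x hs
    exact (hasDerivAt_integral_orderIntegrand x 0 hs).differentiableAt.differentiableWithinAt
  exact (h.contDiffOn Metric.isOpen_ball).contDiffAt (Metric.ball_mem_nhds _ (by norm_num))

theorem integral_orderIntegrand_half (x : ℝ) (m : ℕ) :
    ∫ u in Ioi (0 : ℝ), orderIntegrand x m (1 / 2) u = ((∫ u in Ioi (0 : ℝ),
      Real.cos (x * u) * Real.log (u ^ 2 + 1) ^ m / (u ^ 2 + 1) : ℝ) : ℂ) := by
  rw [← integral_complex_ofReal]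
  simp [orderIntegrand]

end BesselOrder

theorem theorem2 (n : ℕ) (hn : 1 ≤ n) :
    (∀ x : ℝ, 0 < x →
      -- `T[s, x]` converges for `s` near `1/2`, and is `n` times differentiable there
      (∀ᶠ s : ℂ in 𝓝 (1 / 2 : ℂ),
        Tendsto (fun R : ℝ => BesselOrder.partialT s x R) atTop (𝓝 (BesselOrder.T s x))) ∧
      ContDiffAt ℂ n (fun s : ℂ => BesselOrder.T s x) (1 / 2) ∧
      -- the integrals below converge absolutely
      IntegrableOn (fun u : ℝ => Real.cos (x * u) * Real.log (u ^ 2 + 1) ^ n / (u ^ 2 + 1))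
        (Ioi 0) ∧
      IntegrableOn (BesselOrder.integrand₂ n x) (Ioi 0) ∧
      (∀ k < n, IntegrableOn (BesselOrder.integrand₃ n k x) (Ioi 0)) ∧
      (∀ k < n, IntegrableOn (BesselOrder.integrand₄ n k x) (Ioi 0)) ∧
      -- the two expressions of the derivative
      iteratedDeriv n (fun s : ℂ => BesselOrder.T s x) (1 / 2) =
        (-1) ^ n *
          ((∫ u in Ioi (0 : ℝ),
            Real.cos (x * u) * Real.log (u ^ 2 + 1) ^ n / (u ^ 2 + 1) : ℝ) : ℂ) ∧
      iteratedDeriv n (fun s : ℂ => BesselOrder.T s x) (1 / 2) =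
        (-1) ^ n * BesselOrder.T (1 / 2) x *
          ((BesselOrder.A₁ n : ℂ) + BesselOrder.A₂ n x + (BesselOrder.A₃ n x : ℂ) +
            (BesselOrder.A₄ n x : ℂ))) ∧
    -- `A_1` is a polynomial in `π` and `log 2`
    (∃ P : MvPolynomial (Fin 2) ℚ,
      BesselOrder.A₁ n = MvPolynomial.aeval ![Real.pi, Real.log 2] P) ∧
    -- `A_2`, `A_3` and `A_4` are finite linear combinations of the integrals `U[a, b, ε]`
    (∀ (a b ε : ℕ) (x : ℝ), ε ≤ 1 → 0 < x →
      IntegrableOn (BesselOrder.integrandU a b ε x) (Ioi 0)) ∧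
    (∃ c₂ c₃ c₄ : ℕ → ℕ → ℝ, ∀ x : ℝ, 0 < x →
      BesselOrder.A₂ n x =
        ((∑ a ∈ Finset.range (n + 1), ∑ b ∈ Finset.range (n + 1),
          c₂ a b * BesselOrder.U a b 1 x : ℝ) : ℂ) ∧
      BesselOrder.A₃ n x =
        x * ∑ a ∈ Finset.range (n + 1), ∑ b ∈ Finset.range (n + 1),
          c₃ a b * BesselOrder.U a b 0 x ∧
      BesselOrder.A₄ n x =
        ∑ a ∈ Finset.range (n + 1), ∑ b ∈ Finset.range (n + 1),
          c₄ a b * BesselOrder.U a b 1 x) := by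

  have hmem : (1 / 2 : ℂ) ∈ Metric.ball (1 / 2 : ℂ) (1 / 8) := Metric.mem_ball_self (by norm_num)
  refine ⟨fun x hx => ?_, BesselOrder.exists_mvPolynomial_A₁ n,
    fun a b ε x _ hx => BesselOrder.integrableOn_integrandU a b ε hx,
    BesselOrder.exists_coefficients n⟩
  have hderiv := (BesselOrder.iteratedDeriv_T x n _ hmem).trans
    (congrArg _ (BesselOrder.integral_orderIntegrand_half x n))
  refine ⟨?_, BesselOrder.contDiffAt_T x n,
    (BesselOrder.integrable_cos_mul_log_pow n x).integrableOn,
    BesselOrder.integrableOn_integrand₂ n hx,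
    fun k hk => BesselOrder.integrableOn_integrand₃ hk hx,
    fun k hk => BesselOrder.integrableOn_integrand₄ hk hx, hderiv, ?_⟩
  · filter_upwards [Metric.ball_mem_nhds (1 / 2 : ℂ) (by norm_num : (0 : ℝ) < 1 / 8)] with s hs
    rw [BesselOrder.T_eq x hs]
    exact BesselOrder.tendsto_partialT x hs
  · -- The case `n = 0` of the same contour integral gives `T[1/2, x] = π e^(-x) / 2`.
    rw [hderiv, BesselOrder.sum_A_eq n hx, BesselOrder.T_eq x hmem,
      BesselOrder.integral_orderIntegrand_half, BesselOrder.integral_cos_mul_log_pow n hx,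
      BesselOrder.integral_cos_mul_log_pow 0 hx, BesselOrder.totalSum_zero hx]
    push_cast
    ring
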